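/- Let $\langle x,y\rangle=\sum_i x_iy_i$ denote the inner product of $\mathbb R^d$ and its bilinear extension to $\mathbb C^d\times\mathbb C^d$, and write $\|w\|^2=\sum_i w_i^2$ for $w\in\mathbb C^d$. Let $R\subset\mathbb R^d\setminus\{0\}$ be a finite root system, i.e. a finite set stable under the reflections $\sigma_\alpha(x)=x-2\frac{\langle x,\alpha\rangle}{\|\alpha\|^2}\alpha$, $\alpha\in R$; let $G$ be the group generated by these reflections, and put $R_+=\{\alpha\in R:\langle\alpha,\beta\rangle>0\}$ for some $\beta\in\mathbb R^d$ with $\langle\alpha,\beta\rangle\neq0$ for all $\alpha\in R$. Let $k:R\to\mathbb C$ be $G$-invariant, with Dunkl operators $$T_\xi f(x)=\partial_\xi f(x)+\sum_{\alpha\in R_+}k(\alpha)\langle\alpha,\xi\rangle\frac{f(x)-f(\sigma_\alpha x)}{\langle\alpha,x\rangle}\qquad(\xi,x\in\mathbb R^d),$$ where on the hyperplane $\langle\alpha,x\rangle=0$ the quotient is read as its continuous extension $2\,\partial_\alpha f(x)/\|\alpha\|^2$. Let $\mathcal P=\mathbb C[\mathbb R^d]$, let $\mathcal P_n$ be its subspace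 of homogeneous polynomials of degree $n$, and assume $k\in M^*$, that is, for every $n\ge1$ the operator $$W_n p=\Big(n+\sum_{\alpha\in R_+}k(\alpha)\Big)p-\sum_{\alpha\in R_+}k(\alpha)\,p\circ\sigma_\alpha$$ is invertible on $\mathcal P_n$. Then the following objects are well defined: (a) the intertwining operator $V_k$, the unique linear isomorphism of $\mathcal P$ with $V_k(\mathcal P_n)\subset\mathcal P_n$ for all $n$, $V_k1=1$ and $T_\xi V_k=V_k\partial_\xi$ for all $\xi\in\mathbb R^d$; (b) the Dunkl kernel $E_k$, the unique holomorphic function on $\mathbb C^d\times\mathbb C^d$ such that for every $y\in\mathbb R^d$ the function $f=E_k(\cdot,y)$ on $\mathbb R^d$ satisfies $f(0)=1$ and $T_\xi f=\langle\xi,y\rangle f$ for all $\xi\in\mathbb R^d$; (c) the kernel $$L_k(x,z)=\sum_{n=0}^\infty\big(e^{-\Delta/2}E_n(x,\cdot)\big)(z)\quad(x\in\mathbb C^d,\ z\in\mathbb R^d),\qquad E_n(x,y)=\tfrac1{n!}V_k\big(\langle\cdot,y\rangle^n\big)(x),$$ where $\Delta$ is the Laplacian on $\mathbb R^d$, $e^{-\Delta/2}=\sum_m\frac{(-1)^m}{2^m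 m!}\Delta^m$ on polynomials, and the series converges absolutely. Moreover, with $c_0=(2\pi)^{d/2}$, for all $x,y\in\mathbb C^d$ the following integral converges absolutely and $$E_k(x,y)=c_0^{-1}\int_{\mathbb R^d}L_k(x,z)\,e^{-\|y-z\|^2/2}\,dz=c_0^{-1}\,\big(L_k(x,\cdot)*e^{-\|\cdot\|^2/2}\big)(y),$$ where the convolution of a function $f$ on $\mathbb R^d$ with a function $g$ on $\mathbb C^d$ is $(f*g)(y)=\int_{\mathbb R^d}f(z)g(y-z)\,dz$. -/

import Mathlib

namespace Dunkl

noncomputable section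

/-- The Euclidean space `ℝ^d`. -/
abbrev RSpace (d : ℕ) : Type := EuclideanSpace ℝ (Fin d)

/-- The complexification `ℂ^d`. -/
abbrev CSpace (d : ℕ) : Type := Fin d → ℂ

/-- The inclusion `ℝ^d ⊂ ℂ^d`. -/
def toC {d : ℕ} (x : RSpace d) : CSpace d := fun i => (x i : ℂ)

/-- The bilinear (not sesquilinear) extension of the inner product of `ℝ^d` to `ℂ^d × ℂ^d`. -/
def pairing {d : ℕ} (x y : CSpace d) : ℂ := ∑ i, x i * y i

theorem pairing_toC {d : ℕ} (x y : RSpace d) :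
    pairing (toC x) (toC y) = ((inner ℝ x y : ℝ) : ℂ) := by
  simp [pairing, toC, PiLp.inner_apply, mul_comm]

/-- The polynomial algebra `ℂ[ℝ^d]`. -/
abbrev Poly (d : ℕ) : Type := MvPolynomial (Fin d) ℂ

/-- The polynomial function on `ℝ^d` defined by a polynomial. -/
def polyFun {d : ℕ} (p : Poly d) : RSpace d → ℂ := fun x => MvPolynomial.eval (toC x) p

/-! ### Root systems and reflection groups -/

/-- The orthogonal reflection in the hyperplane `α^⊥`. -/
def refl {d : ℕ} (α : RSpace d) : RSpace d ≃ₗᵢ[ℝ] RSpace d :=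
  (Submodule.span ℝ {α})ᗮ.reflection

theorem refl_apply {d : ℕ} (α x : RSpace d) :
    refl α x = x - (2 * inner ℝ x α / ‖α‖ ^ 2) • α := by
  rw [refl, Submodule.reflection_orthogonal_apply, Submodule.reflection_singleton_apply,
    real_inner_comm α x]
  simp only [neg_sub, RCLike.ofReal_real_eq_id, id_eq, two_smul]
  congr 1
  rw [← add_smul]
  congr 1
  ring

/-- `R` is a finite root system in `ℝ^d`: it consists of nonzero vectors and is stable under all
reflections `σ_α`, `α ∈ R` (hence `-α ∈ R` for `α ∈ R`). It may be empty, and need not span, be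
reduced or be crystallographic. -/
structure IsRootSystem {d : ℕ} (R : Finset (RSpace d)) : Prop where
  ne_zero : ∀ α ∈ R, α ≠ 0
  refl_mem : ∀ α ∈ R, ∀ β ∈ R, refl α β ∈ R

/-- The group `G` generated by the reflections `σ_α`, `α ∈ R`. -/
def reflGroup {d : ℕ} (R : Finset (RSpace d)) : Subgroup (RSpace d ≃ₗᵢ[ℝ] RSpace d) :=
  Subgroup.closure {g | ∃ α ∈ R, g = refl α}

/-- The positive roots `R_+ = {α ∈ R : ⟨α, β⟩ > 0}`. -/
def posRoots {d : ℕ} (R : Finset (RSpace d)) (β : RSpace d) : Finset (RSpace d) :=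
  open Classical in R.filter fun α => 0 < (inner ℝ α β : ℝ)

/-- `k` is a parameter function on `R`, i.e. a `G`-invariant function `R → ℂ` (only its values on
`R` are ever used). -/
def IsParameter {d : ℕ} (R : Finset (RSpace d)) (k : RSpace d → ℂ) : Prop :=
  ∀ g ∈ reflGroup R, ∀ α ∈ R, k (g α) = k α

/-! ### Dunkl operators -/

/-- The difference quotient `(f x - f (σ_α x)) / ⟨α, x⟩`; on the hyperplane `⟨α, x⟩ = 0` it is the
value `2 ∂_α f (x) / ‖α‖²` of its continuous extension (for `f` of class `C¹`). -/
def diffQuot {d : ℕ} (α : RSpace d) (f : RSpace d → ℂ) (x : RSpace d) : ℂ :=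
  open Classical in
  if (inner ℝ α x : ℝ) = 0 then ((2 / ‖α‖ ^ 2 : ℝ) : ℂ) * fderiv ℝ f x α
  else (f x - f (refl α x)) / ((inner ℝ α x : ℝ) : ℂ)

/-- The Dunkl operator
`T_ξ f (x) = ∂_ξ f (x) + ∑_{α ∈ R_+} k(α) ⟨α, ξ⟩ (f(x) - f(σ_α x)) / ⟨α, x⟩`. -/
def dunklOp {d : ℕ} (R : Finset (RSpace d)) (β : RSpace d) (k : RSpace d → ℂ) (ξ : RSpace d)
    (f : RSpace d → ℂ) (x : RSpace d) : ℂ :=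
  fderiv ℝ f x ξ + ∑ α ∈ posRoots R β, k α * ((inner ℝ α ξ : ℝ) : ℂ) * diffQuot α f x

/-! ### The class `M^*` -/

/-- The action `(L_g p)(x) = p(g x)` on polynomials. -/
def polyAct {d : ℕ} (g : RSpace d ≃ₗᵢ[ℝ] RSpace d) : Poly d →ₗ[ℂ] Poly d :=
  (MvPolynomial.aeval fun i : Fin d =>
    ∑ j, MvPolynomial.C ((g (EuclideanSpace.single j 1) i : ℝ) : ℂ) *
      MvPolynomial.X j : Poly d →ₐ[ℂ] Poly d).toLinearMap

theorem polyFun_polyAct {d : ℕ} (g : RSpace d ≃ₗᵢ[ℝ] RSpace d) (p : Poly d) (x : RSpace d) :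
    polyFun (polyAct g p) x = polyFun p (g x) := by
  have hx : ∀ i, g x i = ∑ j, g (EuclideanSpace.single j 1) i * x j := by
    intro i
    have h : x = ∑ j, x j • (EuclideanSpace.single j (1 : ℝ)) := by
      ext l
      simp [Pi.single_apply]
    conv_lhs => rw [h]
    simp [map_sum, mul_comm]
  have h1 : toC (g x) = fun i => MvPolynomial.eval (toC x)
      (∑ j, MvPolynomial.C ((g (EuclideanSpace.single j 1) i : ℝ) : ℂ) * MvPolynomial.X j) := by
    funext i
    simp [toC, hx]
  induction p using MvPolynomial.induction_on with
  | C a => simp [polyFun, polyAct]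
  | add p q hp hq =>
    simp only [polyFun, map_add] at hp hq ⊢
    rw [hp, hq]
  | mul_X p i hp =>
    simp only [polyFun, polyAct, AlgHom.toLinearMap_apply, map_mul, MvPolynomial.aeval_X,
      MvPolynomial.eval_X] at hp ⊢
    rw [hp, h1]

/-- The operator `W_n = (n + γ) - A`, where `A = ∑_{α ∈ R_+} k(α) L_{σ_α}` and
`γ = ∑_{α ∈ R_+} k(α)`. -/
def opW {d : ℕ} (R : Finset (RSpace d)) (β : RSpace d) (k : RSpace d → ℂ) (n : ℕ) :
    Poly d →ₗ[ℂ] Poly d :=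
  ((n : ℂ) + ∑ α ∈ posRoots R β, k α) • LinearMap.id
    - ∑ α ∈ posRoots R β, k α • polyAct (refl α)

/-- `k ∈ M^*`: for every `n ≥ 1` the operator `W_n` is invertible on the space of homogeneous
polynomials of degree `n`. -/
def InMStar {d : ℕ} (R : Finset (RSpace d)) (β : RSpace d) (k : RSpace d → ℂ) : Prop :=
  ∀ n : ℕ, 1 ≤ n → Set.BijOn (opW R β k n)
    (MvPolynomial.homogeneousSubmodule (Fin d) ℂ n : Set (Poly d))
    (MvPolynomial.homogeneousSubmodule (Fin d) ℂ n : Set (Poly d))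

/-! ### The intertwining operator -/

/-- The directional derivative `∂_ξ` on polynomials. -/
def polyDeriv {d : ℕ} (ξ : RSpace d) (p : Poly d) : Poly d :=
  ∑ i, ((ξ i : ℝ) : ℂ) • MvPolynomial.pderiv i p

/-- `V` is a linear isomorphism of the space of polynomials with `V(P_n) ⊂ P_n`, `V(1) = 1` and
`T_ξ V = V ∂_ξ` for all `ξ`. -/
structure IsIntertwiner {d : ℕ} (R : Finset (RSpace d)) (β : RSpace d) (k : RSpace d → ℂ)
    (V : Poly d ≃ₗ[ℂ] Poly d) : Prop where
  map_homogeneous : ∀ (n : ℕ) (p : Poly d), p.IsHomogeneous n → (V p).IsHomogeneous n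
  map_one : V 1 = 1
  intertwines : ∀ (ξ : RSpace d) (p : Poly d) (x : RSpace d),
    dunklOp R β k ξ (polyFun (V p)) x = polyFun (V (polyDeriv ξ p)) x

/-- The intertwining operator `V_k`. -/
def intertwiner {d : ℕ} (R : Finset (RSpace d)) (β : RSpace d) (k : RSpace d → ℂ) :
    Poly d ≃ₗ[ℂ] Poly d :=
  Classical.epsilon (IsIntertwiner R β k)

/-! ### The Dunkl kernel -/

/-- `E` is a Dunkl kernel: it is holomorphic on `ℂ^d × ℂ^d` and for every `y ∈ ℝ^d` the function
`f = E(·, y)` on `ℝ^d` solves `f(0) = 1`, `T_ξ f = ⟨ξ, y⟩ f` for all `ξ ∈ ℝ^d`. -/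
structure IsDunklKernel {d : ℕ} (R : Finset (RSpace d)) (β : RSpace d) (k : RSpace d → ℂ)
    (E : CSpace d → CSpace d → ℂ) : Prop where
  holomorphic : Differentiable ℂ fun q : CSpace d × CSpace d => E q.1 q.2
  map_zero : ∀ y : RSpace d, E 0 (toC y) = 1
  eigen : ∀ (y ξ x : RSpace d),
    dunklOp R β k ξ (fun u => E (toC u) (toC y)) x
      = ((inner ℝ ξ y : ℝ) : ℂ) * E (toC x) (toC y)

/-- The Dunkl kernel `E_k`. -/
def dunklKernel {d : ℕ} (R : Finset (RSpace d)) (β : RSpace d) (k : RSpace d → ℂ) :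
    CSpace d → CSpace d → ℂ :=
  Classical.epsilon (IsDunklKernel R β k)

/-! ### The kernel `L_k` -/

/-- The linear form `x ↦ ⟨x, y⟩` as a polynomial. -/
def linForm {d : ℕ} (y : CSpace d) : Poly d :=
  ∑ i, MvPolynomial.C (y i) * MvPolynomial.X i

/-- `E_n(x, y) = (1 / n!) V_k(⟨·, y⟩^n)(x)` for `x, y ∈ ℂ^d`. -/
def kernelE {d : ℕ} (R : Finset (RSpace d)) (β : RSpace d) (k : RSpace d → ℂ) (n : ℕ)
    (x y : CSpace d) : ℂ :=
  ((n.factorial : ℂ))⁻¹ * MvPolynomial.eval x (intertwiner R β k (linForm y ^ n))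

/-- `e^{-Δ/2} f (y) = ∑_m (-1/2)^m / m! · Δ^m f (y)`, a finite sum when `f` is a polynomial
function on `ℝ^d`. -/
def expNegHalfLaplacian {d : ℕ} (f : RSpace d → ℂ) (y : RSpace d) : ℂ :=
  ∑' m : ℕ, ((-1 / 2 : ℂ) ^ m / (m.factorial : ℂ)) * (Laplacian.laplacian^[m] f) y

/-- The `n`-th term `(e^{-Δ/2} E_n(x, ·))(y)` of the series defining `L_k(x, y)`. -/
def kernelLTerm {d : ℕ} (R : Finset (RSpace d)) (β : RSpace d) (k : RSpace d → ℂ)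
    (x : CSpace d) (y : RSpace d) (n : ℕ) : ℂ :=
  expNegHalfLaplacian (fun u => kernelE R β k n x (toC u)) y

/-- `L_k(x, y) = ∑_n (e^{-Δ/2} E_n(x, ·))(y)` for `x ∈ ℂ^d`, `y ∈ ℝ^d`. -/
def kernelL {d : ℕ} (R : Finset (RSpace d)) (β : RSpace d) (k : RSpace d → ℂ)
    (x : CSpace d) (y : RSpace d) : ℂ :=
  ∑' n : ℕ, kernelLTerm R β k x y n

/-! ### Gaussian convolution -/

/-- `w ↦ e^{-‖w‖²/2}` on `ℂ^d`, where `‖w‖² = w_1² + ⋯ + w_d²`. -/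
def gauss {d : ℕ} (w : CSpace d) : ℂ := Complex.exp (-pairing w w / 2)

/-- The constant `c_0 = (2π)^{d/2}`. -/
def c0 (d : ℕ) : ℝ := (2 * Real.pi) ^ ((d : ℝ) / 2)

/-- The convolution `(f * g)(y) = ∫_{ℝ^d} f(z) g(y - z) dz` of a function on `ℝ^d` with a function
on `ℂ^d`, evaluated at `y ∈ ℂ^d`. -/
def cconv {d : ℕ} (f : RSpace d → ℂ) (g : CSpace d → ℂ) (y : CSpace d) : ℂ :=
  ∫ z : RSpace d, f z * g (y - toC z)

theorem cconv_toC {d : ℕ} (f : RSpace d → ℂ) (g : CSpace d → ℂ) (y : RSpace d) :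
    cconv f g (toC y) = MeasureTheory.convolution f (fun z => g (toC z))
      (ContinuousLinearMap.mul ℝ ℂ) MeasureTheory.volume y := by
  have h : ∀ z : RSpace d, toC y - toC z = toC (y - z) := by
    intro z
    funext i
    simp [toC]
  simp [cconv, MeasureTheory.convolution, h]

end

end Dunkl

/-!
The operators `W_n` enter through Euler's identity: on homogeneous polynomials of degree `n`, the sum
`∑_i x_i T_i` of the Dunkl operators `T_i = T_{e_i}` is `W_n` (`sum_X_mul_polyDunkl`). Invertibility
of all `W_n`, `n ≥ 1`, therefore says that homogeneous polynomials of positive degree are determined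
by their images under the `T_i` (`eq_of_polyDunkl_eq`), and every uniqueness statement is an
induction on the degree based on this.

*The intertwining operator.* The Dunkl operators commute: `[T_ξ, T_η]` kills constants and, by
equivariance under the reflections, commutes with multiplication by linear forms
(`polyDunkl_comm`). Hence the inverse `U` of `V_k` can be built directly. The recursion
`U_{n+1} q = (n+1)⁻¹ ∑_i x_i U_n (T_i q)` integrates a closed one-form and yields `∂_ξ U = U T_ξ`
(`polyDeriv_invIntertwinerAux`); injectivity of `U` in each degree follows from that of `W_n`, and
the spaces of homogeneous polynomials are finite-dimensional (`exists_isIntertwiner`).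

*The Dunkl kernel.* The components `E_n(·, y)` satisfy `T_ξ E_{n+1} = ⟨ξ, y⟩ E_n`, hence
`W_{n+1} E_{n+1} = ⟨·, y⟩ E_n`. As `W_n - n` is bounded uniformly in `n` for the supremum over
Hermitian unit balls, which the reflections preserve, it follows that
`|E_n(x, y)| ≤ C (2 ‖x‖ ‖y‖)^n / n!` (`exists_kernelE_bound`). So `∑ E_n` converges to a Dunkl kernel
(`isDunklKernel_tsum`). Conversely, the homogeneous Taylor polynomials of any joint eigenfunction
obey the same recursion, with `W_n` acting (`exists_taylor_recursion`), which gives uniqueness for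
real `y`, and for complex `y` because `ℝ^d` is a set of uniqueness for entire functions on `ℂ^d`
(`eq_zero_of_forall_toC`).

*The integral representation.* Integration by parts against a Gaussian shows that
`q ↦ ∫ q(a + c u) e^{-‖b - u‖²/2} du` satisfies a recursion in the degree of `q`
(`gaussFunctional_X_mul`), and such recursions have a unique solution (`linearMap_eq_of_X_mul`). Two
cases are needed. With `a = 0`, `c = 1` it shows that the Gauss transform of `e^{-Δ/2} q` is `q`, at
all points of `ℂ^d` (`integral_expNegHalfPolyLaplacian`); applied to `q = E_n(x, ·)` and summed over
`n` this is the assertion. With `b = 0`, `c = i` it represents `e^{-Δ/2} q (z)` as the mean of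
`q(z + iu)` over a Gaussian `u` (`integral_eval_add_I_smul`). Together with the estimate of `E_n` this
bounds the `n`-th term of `L_k(x, z)` by `D e^{A ‖z‖} 2^{-n}` (`exists_kernelLTerm_bound`), which gives
absolute convergence, integrability and the right to sum under the integral.
-/

namespace Dunkl

noncomputable section

open MvPolynomial MeasureTheory

variable {d : ℕ} {R : Finset (RSpace d)} {β : RSpace d} {k : RSpace d → ℂ}

/-! ### Polynomial functions and the reflection action -/

theorem toC_smul (r : ℝ) (x : RSpace d) : toC (r • x) = (r : ℂ) • toC x := by
  funext i
  simp [toC]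

theorem toC_single (i : Fin d) : toC (EuclideanSpace.single i (1 : ℝ)) = Pi.single i 1 := by
  funext j
  by_cases h : j = i
  · subst h
    simp [toC]
  · simp [toC, h]

theorem pairing_comm (x y : CSpace d) : pairing x y = pairing y x := by
  simp [pairing, mul_comm]

theorem eval_linForm (x y : CSpace d) : eval x (linForm y) = pairing x y := by
  simp [linForm, pairing, mul_comm]

theorem linForm_smul (c : ℂ) (y : CSpace d) : linForm (c • y) = C c * linForm y := by
  simp [linForm, Finset.mul_sum, mul_assoc]

theorem linForm_single (i : Fin d) : linForm (Pi.single i 1 : CSpace d) = X i := by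
  rw [linForm, Finset.sum_eq_single i] <;> simp +contextual

theorem isHomogeneous_linForm (y : CSpace d) : (linForm y).IsHomogeneous 1 :=
  IsHomogeneous.sum _ _ _ fun _ _ => isHomogeneous_C_mul_X _ _

theorem linForm_ne_zero {α : RSpace d} (hα : α ≠ 0) : linForm (toC α) ≠ 0 := by
  intro h
  have h1 : eval (toC α) (linForm (toC α)) = 0 := by rw [h, map_zero]
  rw [eval_linForm, pairing_toC] at h1
  exact hα (by simpa using h1)

/-- A polynomial is determined by its values on `ℝ^d`. -/
theorem polyFun_injective : Function.Injective (polyFun : Poly d → RSpace d → ℂ) := by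
  intro p q h
  refine MvPolynomial.funext_set (fun _ => Set.range ((↑) : ℝ → ℂ))
    (fun _ => Set.infinite_range_of_injective Complex.ofReal_injective) fun x hx => ?_
  choose r hr using fun i => hx i (Set.mem_univ i)
  have h2 : toC (WithLp.toLp 2 r : RSpace d) = x := by
    funext i
    simp [toC, hr]
  have h3 := congrFun h (WithLp.toLp 2 r)
  simpa only [polyFun, h2] using h3

theorem polyFun_linForm (α x : RSpace d) :
    polyFun (linForm (toC α)) x = ((inner ℝ α x : ℝ) : ℂ) := by
  rw [polyFun, eval_linForm, pairing_comm, pairing_toC]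

theorem polyFun_mul (p q : Poly d) (x : RSpace d) :
    polyFun (p * q) x = polyFun p x * polyFun q x := by simp [polyFun]

theorem polyFun_add (p q : Poly d) (x : RSpace d) :
    polyFun (p + q) x = polyFun p x + polyFun q x := by simp [polyFun]

theorem polyFun_sub (p q : Poly d) (x : RSpace d) :
    polyFun (p - q) x = polyFun p x - polyFun q x := by simp [polyFun]

theorem polyFun_smul (c : ℂ) (p : Poly d) (x : RSpace d) :
    polyFun (c • p) x = c * polyFun p x := by simp [polyFun]

theorem polyFun_sum {ι : Type*} (s : Finset ι) (p : ι → Poly d) (x : RSpace d) :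
    polyFun (∑ i ∈ s, p i) x = ∑ i ∈ s, polyFun (p i) x := by simp [polyFun]

theorem polyAct_mul (g : RSpace d ≃ₗᵢ[ℝ] RSpace d) (p q : Poly d) :
    polyAct g (p * q) = polyAct g p * polyAct g q := by
  simp [polyAct]

theorem polyAct_C (g : RSpace d ≃ₗᵢ[ℝ] RSpace d) (c : ℂ) : polyAct g (C c : Poly d) = C c := by
  simp [polyAct]

theorem isHomogeneous_polyAct (g : RSpace d ≃ₗᵢ[ℝ] RSpace d) {n : ℕ} {p : Poly d}
    (hp : p.IsHomogeneous n) : (polyAct g p).IsHomogeneous n := by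
  have := hp.aeval (fun i : Fin d =>
    (∑ j, C ((g (EuclideanSpace.single j 1) i : ℝ) : ℂ) * X j : Poly d))
    (n := 1) fun i => IsHomogeneous.sum _ _ _ fun j _ => isHomogeneous_C_mul_X _ _
  rw [one_mul] at this
  exact this

theorem refl_refl (α x : RSpace d) : refl α (refl α x) = x :=
  Submodule.reflection_reflection _ _

theorem inner_refl_left (α x y : RSpace d) :
    (inner ℝ (refl α x) y : ℝ) = inner ℝ x (refl α y) := by
  conv_lhs => rw [← refl_refl α y]
  exact (refl α).inner_map_map _ _

theorem refl_self (α : RSpace d) : refl α α = -α := by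
  by_cases h : α = 0
  · simp [h]
  · rw [refl_apply, real_inner_self_eq_norm_sq, mul_div_assoc, div_self (by simpa using h), mul_one,
      two_smul]
    abel

theorem refl_neg (α : RSpace d) : refl (-α) = refl α := by
  ext1 x
  simp [refl_apply, neg_div]

/-- `σ_α (⟨·, ζ⟩) = ⟨·, ζ⟩ - (2⟨α,ζ⟩/‖α‖²) ⟨·, α⟩`. -/
theorem polyAct_refl_linForm (α ζ : RSpace d) :
    polyAct (refl α) (linForm (toC ζ)) =
      linForm (toC ζ) - C (((2 * inner ℝ α ζ / ‖α‖ ^ 2 : ℝ)) : ℂ) * linForm (toC α) := by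
  apply polyFun_injective
  funext x
  rw [polyFun_polyAct, polyFun_sub, polyFun_mul, polyFun_linForm, polyFun_linForm,
    polyFun_linForm, refl_apply]
  simp only [polyFun, eval_C, inner_sub_right, inner_smul_right]
  rw [real_inner_comm α ζ, real_inner_comm α x]
  push_cast
  ring

/-! ### Divided differences -/

theorem linForm_dvd_sub_polyAct (α : RSpace d) (p : Poly d) :
    linForm (toC α) ∣ p - polyAct (refl α) p := by
  induction p using MvPolynomial.induction_on with
  | C a => simp [polyAct_C]
  | add p q hp hq =>
    rw [map_add, add_sub_add_comm]
    exact dvd_add hp hq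
  | mul_X p i hp =>
    rw [polyAct_mul, ← linForm_single i, ← toC_single, polyAct_refl_linForm]
    obtain ⟨r, hr⟩ := hp
    refine ⟨r * linForm (toC (EuclideanSpace.single i 1)) + polyAct (refl α) p *
      C (((2 * inner ℝ α (EuclideanSpace.single i (1 : ℝ)) / ‖α‖ ^ 2 : ℝ)) : ℂ), ?_⟩
    linear_combination linForm (toC (EuclideanSpace.single i 1)) * hr

/-- The divided difference `(p - p ∘ σ_α) / ⟨α, ·⟩` on polynomials; it is set to `0` for `α = 0`. -/
def divDiff (α : RSpace d) : Poly d →ₗ[ℂ] Poly d :=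
  open Classical in
  if hα : α = 0 then 0 else
  { toFun := fun p => (linForm_dvd_sub_polyAct α p).choose
    map_add' := fun p q => by
      apply mul_left_cancel₀ (linForm_ne_zero hα)
      rw [mul_add, ← (linForm_dvd_sub_polyAct α p).choose_spec,
        ← (linForm_dvd_sub_polyAct α q).choose_spec,
        ← (linForm_dvd_sub_polyAct α (p + q)).choose_spec, map_add]
      ring
    map_smul' := fun c p => by
      apply mul_left_cancel₀ (linForm_ne_zero hα)
      rw [RingHom.id_apply, mul_smul_comm, ← (linForm_dvd_sub_polyAct α p).choose_spec,
        ← (linForm_dvd_sub_polyAct α (c • p)).choose_spec, map_smul, smul_sub] }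

theorem linForm_mul_divDiff {α : RSpace d} (hα : α ≠ 0) (p : Poly d) :
    linForm (toC α) * divDiff α p = p - polyAct (refl α) p := by
  rw [divDiff, dif_neg hα]
  exact (linForm_dvd_sub_polyAct α p).choose_spec.symm

theorem divDiff_eq_of_mul_eq {α : RSpace d} (hα : α ≠ 0) {p q : Poly d}
    (h : linForm (toC α) * q = p - polyAct (refl α) p) : divDiff α p = q :=
  mul_left_cancel₀ (linForm_ne_zero hα) ((linForm_mul_divDiff hα p).trans h.symm)

theorem divDiff_C {α : RSpace d} (hα : α ≠ 0) (c : ℂ) : divDiff α (C c) = 0 :=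
  divDiff_eq_of_mul_eq hα (by simp [polyAct_C])

theorem divDiff_neg {α : RSpace d} (hα : α ≠ 0) (p : Poly d) :
    divDiff (-α) p = -divDiff α p := by
  refine divDiff_eq_of_mul_eq (neg_ne_zero.2 hα) ?_
  rw [refl_neg, ← linForm_mul_divDiff hα p, ← neg_one_smul ℝ α, toC_smul, linForm_smul]
  simp

theorem divDiff_linForm_mul {α : RSpace d} (hα : α ≠ 0) (ζ : RSpace d) (p : Poly d) :
    divDiff α (linForm (toC ζ) * p) = linForm (toC ζ) * divDiff α p +
      C (((2 * inner ℝ α ζ / ‖α‖ ^ 2 : ℝ)) : ℂ) * polyAct (refl α) p := by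
  refine divDiff_eq_of_mul_eq hα ?_
  rw [polyAct_mul, polyAct_refl_linForm]
  linear_combination linForm (toC ζ) * linForm_mul_divDiff hα p

/-- If the product of a nonzero linear form with `p` is homogeneous, then so is `p`. -/
theorem isHomogeneous_of_mul_left {l p : Poly d} (hl : l.IsHomogeneous 1) (hl0 : l ≠ 0) {n : ℕ}
    (h : (l * p).IsHomogeneous (n + 1)) : p.IsHomogeneous n := by
  have hcomp : ∀ m, l * homogeneousComponent m p = homogeneousComponent (m + 1) (l * p) := by
    intro m
    conv_rhs => rw [← sum_homogeneousComponent p, Finset.mul_sum, map_sum]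
    by_cases hm : m ∈ Finset.range (p.totalDegree + 1)
    · rw [Finset.sum_eq_single m]
      · refine (homogeneousComponent_eq_self ?_).symm
        rw [add_comm]
        exact hl.mul (homogeneousComponent_isHomogeneous m p)
      · intro j _ hj
        have h2 : (l * homogeneousComponent j p).IsHomogeneous (1 + j) :=
          hl.mul (homogeneousComponent_isHomogeneous j p)
        rw [homogeneousComponent_of_mem h2, if_neg (by omega)]
      · exact fun h => (h hm).elim
    · rw [homogeneousComponent_eq_zero _ _ (by simpa using hm), mul_zero]
      refine (Finset.sum_eq_zero fun j hj => ?_).symm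
      have h2 : (l * homogeneousComponent j p).IsHomogeneous (1 + j) :=
        hl.mul (homogeneousComponent_isHomogeneous j p)
      rw [homogeneousComponent_of_mem h2, if_neg]
      rintro h3
      exact hm (by rwa [show m = j by omega])
  have hz : ∀ m, m ≠ n → homogeneousComponent m p = 0 := by
    intro m hm
    have h3 := hcomp m
    rw [homogeneousComponent_of_mem h, if_neg (by omega)] at h3
    exact (mul_eq_zero.1 h3).resolve_left hl0
  have hp : p = homogeneousComponent n p := by
    conv_lhs => rw [← sum_homogeneousComponent p]
    by_cases hn : n ∈ Finset.range (p.totalDegree + 1)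
    · exact Finset.sum_eq_single n (fun j _ hj => hz j hj) fun h => (h hn).elim
    · rw [homogeneousComponent_eq_zero _ _ (by simpa using hn)]
      exact Finset.sum_eq_zero fun j hj => hz j fun h => hn (h ▸ hj)
  rw [hp]
  exact homogeneousComponent_isHomogeneous n p

theorem isHomogeneous_divDiff {α : RSpace d} (hα : α ≠ 0) {n : ℕ} {p : Poly d}
    (hp : p.IsHomogeneous (n + 1)) : (divDiff α p).IsHomogeneous n := by
  refine isHomogeneous_of_mul_left (isHomogeneous_linForm (toC α)) (linForm_ne_zero hα) ?_
  rw [linForm_mul_divDiff hα]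
  exact hp.sub (isHomogeneous_polyAct _ hp)

/-! ### Derivatives of polynomial functions -/

/-- The directional derivative as a linear map. -/
def polyDerivₗ (ξ : RSpace d) : Poly d →ₗ[ℂ] Poly d :=
  ∑ i, ((ξ i : ℝ) : ℂ) • (pderiv i : Derivation ℂ (Poly d) (Poly d)).toLinearMap

theorem polyDerivₗ_apply (ξ : RSpace d) (p : Poly d) : polyDerivₗ ξ p = polyDeriv ξ p := by
  simp [polyDerivₗ, polyDeriv]

theorem polyDeriv_mul (ξ : RSpace d) (p q : Poly d) :
    polyDeriv ξ (p * q) = polyDeriv ξ p * q + p * polyDeriv ξ q := by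
  simp only [polyDeriv, pderiv_mul, Finset.sum_mul, Finset.mul_sum, ← Finset.sum_add_distrib,
    smul_add, mul_smul_comm, smul_mul_assoc]

theorem polyDeriv_C (ξ : RSpace d) (c : ℂ) : polyDeriv ξ (C c : Poly d) = 0 := by
  simp [polyDeriv]

theorem polyDeriv_X (ξ : RSpace d) (i : Fin d) : polyDeriv ξ (X i : Poly d) = C ((ξ i : ℝ) : ℂ) := by
  rw [polyDeriv, Finset.sum_eq_single i]
  · rw [pderiv_X_self, smul_eq_C_mul, mul_one]
  · intro j _ hj
    rw [pderiv_X_of_ne hj.symm, smul_zero]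
  · simp

theorem polyDeriv_linForm (ξ : RSpace d) (y : CSpace d) :
    polyDeriv ξ (linForm y) = C (pairing (toC ξ) y) := by
  rw [← polyDerivₗ_apply, linForm, map_sum]
  simp only [polyDerivₗ_apply, polyDeriv_mul, polyDeriv_C, polyDeriv_X, zero_mul, zero_add,
    pairing, map_sum, toC, map_mul]
  exact Finset.sum_congr rfl fun i _ => mul_comm _ _

theorem polyDeriv_single (i : Fin d) (p : Poly d) :
    polyDeriv (EuclideanSpace.single i (1 : ℝ)) p = pderiv i p := by
  rw [polyDeriv, Finset.sum_eq_single i] <;> simp +contextual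

theorem hasFDerivAt_eval (p : Poly d) (x : CSpace d) :
    HasFDerivAt (fun x : CSpace d => eval x p)
      (∑ i, eval x (pderiv i p) • (ContinuousLinearMap.proj i : CSpace d →L[ℂ] ℂ)) x := by
  induction p using MvPolynomial.induction_on with
  | C a =>
    simp only [eval_C]
    exact (hasFDerivAt_const (𝕜 := ℂ) a x).congr_fderiv (by ext v; simp)
  | add p q hp hq =>
    simp only [map_add]
    exact (hp.fun_add hq).congr_fderiv (by ext v; simp [add_mul, Finset.sum_add_distrib])
  | mul_X p i hp =>
    have hi : HasFDerivAt (fun x : CSpace d => x i)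
      (ContinuousLinearMap.proj i : CSpace d →L[ℂ] ℂ) x := hasFDerivAt_apply i x
    simp only [map_mul, eval_X]
    refine (hp.fun_mul hi).congr_fderiv ?_
    ext v
    simp only [pderiv_mul, map_add, map_mul, eval_X, add_mul, Finset.sum_add_distrib,
      _root_.add_apply, _root_.sum_apply, _root_.smul_apply, ContinuousLinearMap.proj_apply,
      smul_eq_mul]
    rw [add_comm]
    congr 1
    · rw [Finset.mul_sum]
      exact Finset.sum_congr rfl fun j _ => by ring
    · rw [Finset.sum_eq_single i]
      · simp
      · intro j _ hj
        simp [pderiv_X_of_ne hj.symm]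
      · simp

/-- The inclusion `ℝ^d ⊂ ℂ^d` as a real continuous linear map. -/
def toCL : RSpace d →L[ℝ] CSpace d :=
  ContinuousLinearMap.pi fun i => Complex.ofRealCLM ∘L EuclideanSpace.proj i

theorem toCL_apply (x : RSpace d) : toCL x = toC x := rfl

theorem hasFDerivAt_comp_toC {F : CSpace d → ℂ} {F' : CSpace d →L[ℂ] ℂ} {x : RSpace d}
    (h : HasFDerivAt F F' (toC x)) :
    HasFDerivAt (fun u : RSpace d => F (toC u)) ((F'.restrictScalars ℝ) ∘L toCL) x :=
  HasFDerivAt.comp (𝕜 := ℝ) x (f := toC) (h.restrictScalars ℝ) (toCL (d := d)).hasFDerivAt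

theorem differentiable_polyFun (p : Poly d) : Differentiable ℝ (polyFun p) :=
  fun x => (hasFDerivAt_comp_toC (hasFDerivAt_eval p (toC x))).differentiableAt

theorem fderiv_polyFun (p : Poly d) (x ξ : RSpace d) :
    fderiv ℝ (polyFun p) x ξ = polyFun (polyDeriv ξ p) x := by
  have h := hasFDerivAt_comp_toC (hasFDerivAt_eval p (toC x))
  have h2 : fderiv ℝ (polyFun p) x = _ := h.fderiv
  rw [h2, polyDeriv, polyFun_sum]
  simp only [polyFun_smul]
  simp [polyFun, toCL_apply, toC, mul_comm]

/-- On polynomials, the difference quotient with its convention on the hyperplane `⟨α, x⟩ = 0` is the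
divided difference. -/
theorem diffQuot_polyFun {α : RSpace d} (hα : α ≠ 0) (p : Poly d) (x : RSpace d) :
    diffQuot α (polyFun p) x = polyFun (divDiff α p) x := by
  have key : ∀ u, ((inner ℝ α u : ℝ) : ℂ) * polyFun (divDiff α p) u
      = polyFun p u - polyFun p (refl α u) := by
    intro u
    rw [← polyFun_linForm, ← polyFun_mul, linForm_mul_divDiff hα, polyFun_sub, polyFun_polyAct]
  rw [diffQuot]
  split_ifs with h
  · -- differentiate `key` at a point of the hyperplane in the direction `α`
    have hx : refl α x = x := by
      rw [refl_apply, real_inner_comm, h]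
      simp
    have h1 : HasFDerivAt (fun u : RSpace d => polyFun p u - polyFun p (refl α u))
        (fderiv ℝ (polyFun p) x - (fderiv ℝ (polyFun p) x) ∘L
          ((refl α).toContinuousLinearEquiv : RSpace d →L[ℝ] RSpace d)) x := by
      refine (differentiable_polyFun p x).hasFDerivAt.sub ?_
      have h3 : HasFDerivAt (polyFun p) (fderiv ℝ (polyFun p) x) (refl α x) := by
        rw [hx]
        exact (differentiable_polyFun p x).hasFDerivAt
      exact h3.comp x (refl α).toContinuousLinearEquiv.hasFDerivAt
    have h2 : HasFDerivAt (fun u : RSpace d => ((inner ℝ α u : ℝ) : ℂ) * polyFun (divDiff α p) u)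
        _ x := (Complex.ofRealCLM.hasFDerivAt.comp x
          (innerSL ℝ α).hasFDerivAt).mul (differentiable_polyFun (divDiff α p) x).hasFDerivAt
    rw [funext key] at h2
    have h4 := congrArg (fun L => L α) (h1.unique h2)
    simp only [_root_.sub_apply, ContinuousLinearMap.comp_apply,
      _root_.add_apply, _root_.smul_apply, innerSL_apply_apply, h,
      ContinuousLinearEquiv.coe_coe, LinearIsometryEquiv.coe_toContinuousLinearEquiv,
      refl_self, map_neg, Complex.ofRealCLM_apply, Function.comp_apply, Complex.ofReal_zero,
      real_inner_self_eq_norm_sq, smul_eq_mul] at h4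
    have h5 : ((‖α‖ : ℝ) : ℂ) ≠ 0 := by simpa using hα
    push_cast at h4 ⊢
    field_simp
    linear_combination h4
  · rw [div_eq_iff (by exact_mod_cast h), ← key, mul_comm]

/-! ### Root systems -/

theorem mem_posRoots {α : RSpace d} : α ∈ posRoots R β ↔ α ∈ R ∧ 0 < (inner ℝ α β : ℝ) := by
  simp [posRoots]

theorem IsRootSystem.neg_mem (hR : IsRootSystem R) {α : RSpace d} (hα : α ∈ R) : -α ∈ R :=
  refl_self α ▸ hR.refl_mem α hα α hα

theorem IsRootSystem.ne_zero_of_mem_posRoots (hR : IsRootSystem R) {α : RSpace d}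
    (hα : α ∈ posRoots R β) : α ≠ 0 :=
  hR.ne_zero α (mem_posRoots.1 hα).1

theorem IsParameter.refl_apply (hk : IsParameter R k) {γ α : RSpace d} (hγ : γ ∈ R) (hα : α ∈ R) :
    k (refl γ α) = k α :=
  hk _ (Subgroup.subset_closure ⟨γ, hγ, rfl⟩) α hα

theorem IsParameter.neg (hk : IsParameter R k) {α : RSpace d} (hα : α ∈ R) : k (-α) = k α :=
  refl_self α ▸ hk.refl_apply hα hα

/-- The conjugation relation `σ_{σ_γ α} = σ_γ σ_α σ_γ`. -/
theorem refl_refl_apply (γ α x : RSpace d) :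
    refl (refl γ α) x = refl γ (refl α (refl γ x)) := by
  rw [refl_apply (refl γ α), refl_apply α, map_sub, map_smul, refl_refl,
    LinearIsometryEquiv.norm_map, real_inner_comm, inner_refl_left, real_inner_comm]

/-- `R` is the disjoint union of `R_+` and `-R_+`. -/
theorem two_nsmul_sum_posRoots {M : Type*} [AddCommMonoid M] (hR : IsRootSystem R)
    (hβ : ∀ α ∈ R, (inner ℝ α β : ℝ) ≠ 0) {F : RSpace d → M} (hF : ∀ α ∈ R, F (-α) = F α) :
    2 • ∑ α ∈ posRoots R β, F α = ∑ α ∈ R, F α := by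
  classical
  rw [two_nsmul, ← Finset.sum_filter_add_sum_filter_not R (fun α => 0 < (inner ℝ α β : ℝ)) F]
  have h1 : posRoots R β = R.filter fun α => 0 < (inner ℝ α β : ℝ) := by
    ext α
    simp [mem_posRoots]
  rw [h1]
  congr 1
  refine Finset.sum_bij' (fun α _ => -α) (fun α _ => -α) ?_ ?_ ?_ ?_ ?_
  · intro α hα
    rw [Finset.mem_filter] at hα ⊢
    refine ⟨hR.neg_mem hα.1, ?_⟩
    rw [inner_neg_left]
    linarith [hα.2]
  · intro α hα
    rw [Finset.mem_filter] at hα ⊢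
    refine ⟨hR.neg_mem hα.1, ?_⟩
    rw [inner_neg_left]
    have := lt_of_le_of_ne (not_lt.1 hα.2) (hβ α hα.1)
    linarith
  · simp
  · simp
  · intro α hα
    exact (hF α (Finset.mem_filter.1 hα).1).symm

/-- The sum over the positive roots of an even function is invariant under the reflections, since it
is half of the sum over all roots. -/
theorem sum_posRoots_refl (hR : IsRootSystem R) (hβ : ∀ α ∈ R, (inner ℝ α β : ℝ) ≠ 0)
    {F : RSpace d → Poly d} (hF : ∀ α ∈ R, F (-α) = F α) {γ : RSpace d} (hγ : γ ∈ R) :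
    ∑ α ∈ posRoots R β, F (refl γ α) = ∑ α ∈ posRoots R β, F α := by
  have h2 : (2 : ℕ) • ∑ α ∈ posRoots R β, F (refl γ α) = 2 • ∑ α ∈ posRoots R β, F α := by
    rw [two_nsmul_sum_posRoots hR hβ hF, two_nsmul_sum_posRoots hR hβ (F := fun α => F (refl γ α))]
    · exact Finset.sum_bij' (fun α _ => refl γ α) (fun α _ => refl γ α)
        (fun α hα => hR.refl_mem γ hγ α hα) (fun α hα => hR.refl_mem γ hγ α hα)
        (fun α _ => refl_refl γ α) (fun α _ => refl_refl γ α) fun _ _ => rfl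
    · intro α hα
      rw [map_neg, hF _ (hR.refl_mem γ hγ α hα)]
  exact nsmul_right_injective two_ne_zero h2

/-! ### Dunkl operators on polynomials -/

/-- The Dunkl operator `T_ξ` as an endomorphism of the space of polynomials. -/
def polyDunkl (R : Finset (RSpace d)) (β : RSpace d) (k : RSpace d → ℂ) (ξ : RSpace d) :
    Poly d →ₗ[ℂ] Poly d :=
  polyDerivₗ ξ + ∑ α ∈ posRoots R β, (k α * ((inner ℝ α ξ : ℝ) : ℂ)) • divDiff α

theorem polyDunkl_apply (ξ : RSpace d) (p : Poly d) :
    polyDunkl R β k ξ p = polyDeriv ξ p +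
      ∑ α ∈ posRoots R β, (k α * ((inner ℝ α ξ : ℝ) : ℂ)) • divDiff α p := by
  simp [polyDunkl, polyDerivₗ_apply]

theorem dunklOp_polyFun (hR : IsRootSystem R) (ξ : RSpace d) (p : Poly d) (x : RSpace d) :
    dunklOp R β k ξ (polyFun p) x = polyFun (polyDunkl R β k ξ p) x := by
  rw [dunklOp, polyDunkl_apply, polyFun_add, polyFun_sum, fderiv_polyFun]
  congr 1
  refine Finset.sum_congr rfl fun α hα => ?_
  rw [diffQuot_polyFun (hR.ne_zero_of_mem_posRoots hα), polyFun_smul]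

theorem polyDunkl_sub_smul (ξ η : RSpace d) (r : ℝ) (p : Poly d) :
    polyDunkl R β k (ξ - r • η) p = polyDunkl R β k ξ p - (r : ℂ) • polyDunkl R β k η p := by
  simp only [polyDunkl_apply, polyDeriv, inner_sub_right, inner_smul_right, smul_add,
    Finset.smul_sum, smul_smul, PiLp.sub_apply, PiLp.smul_apply, Complex.ofReal_sub,
    Complex.ofReal_mul, sub_smul, mul_sub, Finset.sum_sub_distrib, smul_eq_mul]
  rw [add_sub_add_comm]
  congr 2
  exact Finset.sum_congr rfl fun α _ => by ring_nf

theorem polyDunkl_C (hR : IsRootSystem R) (ξ : RSpace d) (c : ℂ) :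
    polyDunkl R β k ξ (C c) = 0 := by
  rw [polyDunkl_apply, polyDeriv_C, zero_add]
  exact Finset.sum_eq_zero fun α hα => by
    rw [divDiff_C (hR.ne_zero_of_mem_posRoots hα), smul_zero]

theorem isHomogeneous_polyDeriv (ξ : RSpace d) {n : ℕ} {p : Poly d} (hp : p.IsHomogeneous (n + 1)) :
    (polyDeriv ξ p).IsHomogeneous n := by
  refine IsHomogeneous.sum _ _ _ fun i _ => ?_
  rw [smul_eq_C_mul]
  exact (hp.pderiv).C_mul _

theorem isHomogeneous_polyDunkl (hR : IsRootSystem R) (ξ : RSpace d) {n : ℕ} {p : Poly d}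
    (hp : p.IsHomogeneous (n + 1)) : (polyDunkl R β k ξ p).IsHomogeneous n := by
  rw [polyDunkl_apply]
  refine (isHomogeneous_polyDeriv ξ hp).add (IsHomogeneous.sum _ _ _ fun α hα => ?_)
  rw [smul_eq_C_mul]
  exact (isHomogeneous_divDiff (hR.ne_zero_of_mem_posRoots hα) hp).C_mul _

/-- The commutation relation `[T_ξ, ⟨·,ζ⟩] = ⟨ξ,ζ⟩ + ∑_α 2 k(α) ⟨α,ξ⟩⟨α,ζ⟩/‖α‖² σ_α`. -/
theorem polyDunkl_linForm_mul (hR : IsRootSystem R) (ξ ζ : RSpace d) (p : Poly d) :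
    polyDunkl R β k ξ (linForm (toC ζ) * p) = linForm (toC ζ) * polyDunkl R β k ξ p +
      C ((inner ℝ ξ ζ : ℝ) : ℂ) * p + ∑ α ∈ posRoots R β,
        (k α * ((inner ℝ α ξ * (2 * inner ℝ α ζ / ‖α‖ ^ 2) : ℝ) : ℂ)) • polyAct (refl α) p := by
  have h : ∀ α ∈ posRoots R β,
      (k α * ((inner ℝ α ξ : ℝ) : ℂ)) • divDiff α (linForm (toC ζ) * p) =
      linForm (toC ζ) * ((k α * ((inner ℝ α ξ : ℝ) : ℂ)) • divDiff α p) +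
      (k α * ((inner ℝ α ξ * (2 * inner ℝ α ζ / ‖α‖ ^ 2) : ℝ) : ℂ)) • polyAct (refl α) p := by
    intro α hα
    rw [divDiff_linForm_mul (hR.ne_zero_of_mem_posRoots hα), Complex.ofReal_mul]
    simp only [smul_eq_C_mul, map_mul]
    ring
  rw [polyDunkl_apply, Finset.sum_congr rfl h, polyDeriv_mul, polyDeriv_linForm, pairing_toC,
    polyDunkl_apply, Finset.sum_add_distrib, mul_add, Finset.mul_sum]
  ring

theorem polyAct_refl_polyDeriv (γ ξ : RSpace d) (p : Poly d) :
    polyAct (refl γ) (polyDeriv ξ p) = polyDeriv (refl γ ξ) (polyAct (refl γ) p) := by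
  apply polyFun_injective
  funext x
  rw [polyFun_polyAct, ← fderiv_polyFun, ← fderiv_polyFun]
  have h : polyFun (polyAct (refl γ) p) = polyFun p ∘ (refl γ).toContinuousLinearEquiv := by
    funext u
    exact polyFun_polyAct _ _ _
  rw [h, ((differentiable_polyFun p _).hasFDerivAt.comp x
    (refl γ).toContinuousLinearEquiv.hasFDerivAt).fderiv]
  simp [refl_refl]

theorem polyAct_refl_divDiff (γ : RSpace d) {α : RSpace d} (hα : α ≠ 0) (p : Poly d) :
    polyAct (refl γ) (divDiff α p) = divDiff (refl γ α) (polyAct (refl γ) p) := by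
  symm
  refine divDiff_eq_of_mul_eq (by simpa using hα) ?_
  apply polyFun_injective
  funext x
  have h := congrArg (fun q => polyFun q (refl γ x)) (linForm_mul_divDiff hα p)
  simp only [polyFun_mul, polyFun_sub, polyFun_linForm, polyFun_polyAct] at h ⊢
  rw [inner_refl_left, h, refl_refl_apply, refl_refl]

/-- Equivariance: `σ_γ T_ξ = T_{σ_γ ξ} σ_γ`. -/
theorem polyAct_refl_polyDunkl (hR : IsRootSystem R) (hβ : ∀ α ∈ R, (inner ℝ α β : ℝ) ≠ 0)
    (hk : IsParameter R k) {γ : RSpace d} (hγ : γ ∈ R) (ξ : RSpace d) (p : Poly d) :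
    polyAct (refl γ) (polyDunkl R β k ξ p) =
      polyDunkl R β k (refl γ ξ) (polyAct (refl γ) p) := by
  rw [polyDunkl_apply, polyDunkl_apply, map_add, map_sum, polyAct_refl_polyDeriv]
  congr 1
  rw [← sum_posRoots_refl hR hβ (F := fun α => (k α * ((inner ℝ α (refl γ ξ) : ℝ) : ℂ)) •
    divDiff α (polyAct (refl γ) p)) _ hγ]
  · refine Finset.sum_congr rfl fun α hα => ?_
    rw [map_smul, polyAct_refl_divDiff γ (hR.ne_zero_of_mem_posRoots hα),
      hk.refl_apply hγ (mem_posRoots.1 hα).1, LinearIsometryEquiv.inner_map_map]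
  · intro α hα
    simp only [hk.neg hα, divDiff_neg (hR.ne_zero α hα), inner_neg_left, Complex.ofReal_neg,
      mul_neg, neg_smul, smul_neg, neg_neg]

/-- The Dunkl operators commute: `[T_ξ, T_η]` annihilates the constants and commutes with
multiplication by linear forms, hence vanishes. -/
theorem polyDunkl_comm (hR : IsRootSystem R) (hβ : ∀ α ∈ R, (inner ℝ α β : ℝ) ≠ 0)
    (hk : IsParameter R k) (ξ η : RSpace d) (p : Poly d) :
    polyDunkl R β k ξ (polyDunkl R β k η p) = polyDunkl R β k η (polyDunkl R β k ξ p) := by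
  induction p using MvPolynomial.induction_on with
  | C a => simp [polyDunkl_C hR]
  | add p q hp hq => simp only [map_add, hp, hq]
  | mul_X p i hp =>
    -- equivariance, with `T_{σ_α ξ}` expanded by linearity in the direction
    have e : ∀ ξ : RSpace d, ∀ α ∈ posRoots R β, polyDunkl R β k ξ (polyAct (refl α) p) =
        polyAct (refl α) (polyDunkl R β k ξ p) + ((2 * inner ℝ ξ α / ‖α‖ ^ 2 : ℝ) : ℂ) •
          polyDunkl R β k α (polyAct (refl α) p) := by
      intro ξ α hα
      rw [polyAct_refl_polyDunkl hR hβ hk (mem_posRoots.1 hα).1, refl_apply, polyDunkl_sub_smul,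
        sub_add_cancel]
    rw [mul_comm, ← linForm_single i, ← toC_single]
    set ζ : RSpace d := EuclideanSpace.single i 1
    -- apart from the first term, the right-hand side is symmetric in `ξ` and `η`
    have key : ∀ ξ η : RSpace d, polyDunkl R β k ξ (polyDunkl R β k η (linForm (toC ζ) * p)) =
        linForm (toC ζ) * polyDunkl R β k ξ (polyDunkl R β k η p) +
        (C ((inner ℝ ξ ζ : ℝ) : ℂ) * polyDunkl R β k η p +
          C ((inner ℝ η ζ : ℝ) : ℂ) * polyDunkl R β k ξ p) +
        ∑ α ∈ posRoots R β, (((k α * ((inner ℝ α ξ * (2 * inner ℝ α ζ / ‖α‖ ^ 2) : ℝ) : ℂ)) •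
            polyAct (refl α) (polyDunkl R β k η p) +
          (k α * ((inner ℝ α η * (2 * inner ℝ α ζ / ‖α‖ ^ 2) : ℝ) : ℂ)) •
            polyAct (refl α) (polyDunkl R β k ξ p)) +
          (k α * ((inner ℝ α ξ * inner ℝ α η * (2 * inner ℝ α ζ / ‖α‖ ^ 2) *
            (2 / ‖α‖ ^ 2) : ℝ) : ℂ)) • polyDunkl R β k α (polyAct (refl α) p)) := by
      intro ξ η
      have h0 : ∀ (c : ℂ) (q : Poly d), polyDunkl R β k ξ (C c * q) = C c * polyDunkl R β k ξ q :=
        fun c q => by rw [← smul_eq_C_mul, map_smul, smul_eq_C_mul]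
      rw [polyDunkl_linForm_mul hR η, map_add, map_add, polyDunkl_linForm_mul hR ξ, map_sum, h0]
      have h3 : ∀ α ∈ posRoots R β, polyDunkl R β k ξ
          ((k α * ((inner ℝ α η * (2 * inner ℝ α ζ / ‖α‖ ^ 2) : ℝ) : ℂ)) • polyAct (refl α) p) =
          (k α * ((inner ℝ α η * (2 * inner ℝ α ζ / ‖α‖ ^ 2) : ℝ) : ℂ)) •
            polyAct (refl α) (polyDunkl R β k ξ p) +
          (k α * ((inner ℝ α ξ * inner ℝ α η * (2 * inner ℝ α ζ / ‖α‖ ^ 2) *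
            (2 / ‖α‖ ^ 2) : ℝ) : ℂ)) • polyDunkl R β k α (polyAct (refl α) p) := by
        intro α hα
        rw [map_smul, e ξ α hα, smul_add, smul_smul, real_inner_comm α ξ]
        congr 2
        push_cast
        ring
      rw [Finset.sum_congr rfl h3]
      simp only [Finset.sum_add_distrib]
      abel
    rw [key ξ η, key η ξ, hp]
    rw [add_comm (C ((inner ℝ ξ ζ : ℝ) : ℂ) * _)]
    refine congrArg₂ (· + ·) rfl ?_
    refine Finset.sum_congr rfl fun α _ => ?_
    rw [mul_comm (inner ℝ α η : ℝ) (inner ℝ α ξ), add_comm (_ • polyAct (refl α) _)]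

theorem opW_apply (n : ℕ) (p : Poly d) : opW R β k n p =
    ((n : ℂ) + ∑ α ∈ posRoots R β, k α) • p - ∑ α ∈ posRoots R β, k α • polyAct (refl α) p := by
  simp [opW]

/-- The Euler-type identity `∑_i x_i T_i p = W_n p` for `p` homogeneous of degree `n`. -/
theorem sum_X_mul_polyDunkl (hR : IsRootSystem R) {n : ℕ} {p : Poly d} (hp : p.IsHomogeneous n) :
    ∑ i, X i * polyDunkl R β k (EuclideanSpace.single i 1) p = opW R β k n p := by
  have h1 : ∀ i : Fin d, X i * polyDunkl R β k (EuclideanSpace.single i 1) p = X i * pderiv i p +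
      ∑ α ∈ posRoots R β, k α • (C (toC α i) * X i * divDiff α p) := by
    intro i
    rw [polyDunkl_apply, polyDeriv_single, mul_add, Finset.mul_sum]
    congr 1
    refine Finset.sum_congr rfl fun α _ => ?_
    have h2 : (inner ℝ α (EuclideanSpace.single i (1 : ℝ)) : ℝ) = α i := by
      rw [EuclideanSpace.inner_single_right]
      simp
    rw [h2]
    simp only [smul_eq_C_mul, map_mul, toC]
    ring
  simp only [h1]
  rw [Finset.sum_add_distrib, hp.sum_X_mul_pderiv, Finset.sum_comm, opW_apply, add_smul,
    Finset.sum_smul, add_sub_assoc, ← Finset.sum_sub_distrib, Nat.cast_smul_eq_nsmul]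
  congr 1
  refine Finset.sum_congr rfl fun α hα => ?_
  rw [← Finset.smul_sum, ← Finset.sum_mul, ← smul_sub,
    ← linForm_mul_divDiff (hR.ne_zero_of_mem_posRoots hα), linForm]

/-- On homogeneous polynomials of positive degree the Dunkl operators have no common kernel. -/
theorem eq_of_polyDunkl_eq (hR : IsRootSystem R) (hkM : InMStar R β k) {n : ℕ} {p q : Poly d}
    (hp : p.IsHomogeneous (n + 1)) (hq : q.IsHomogeneous (n + 1))
    (h : ∀ i, polyDunkl R β k (EuclideanSpace.single i 1) p =
      polyDunkl R β k (EuclideanSpace.single i 1) q) : p = q := by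
  refine (hkM (n + 1) (by omega)).injOn hp hq ?_
  rw [← sum_X_mul_polyDunkl hR hp, ← sum_X_mul_polyDunkl hR hq]
  exact Finset.sum_congr rfl fun i _ => by rw [h i]

/-! ### Construction of the intertwining operator -/

theorem polyDunkl_eq_sum (ξ : RSpace d) (p : Poly d) :
    polyDunkl R β k ξ p =
      ∑ i, ((ξ i : ℝ) : ℂ) • polyDunkl R β k (EuclideanSpace.single i 1) p := by
  simp only [polyDunkl_apply, smul_add, Finset.sum_add_distrib, polyDeriv_single, Finset.smul_sum]
  rw [Finset.sum_comm]
  congr 1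
  refine Finset.sum_congr rfl fun α _ => ?_
  simp only [smul_smul, ← Finset.sum_smul]
  congr 1
  have h : ∀ i : Fin d, (inner ℝ α (EuclideanSpace.single i (1 : ℝ)) : ℝ) = α i := fun i => by
    rw [EuclideanSpace.inner_single_right]
    simp
  simp only [h, PiLp.inner_apply, RCLike.inner_apply, conj_trivial, Complex.ofReal_sum,
    Complex.ofReal_mul, Finset.mul_sum]
  exact Finset.sum_congr rfl fun i _ => by ring

theorem eq_C_of_isHomogeneous_zero {p : Poly d} (hp : p.IsHomogeneous 0) : p = C (p.coeff 0) :=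
  totalDegree_eq_zero_iff_eq_C.1 ((totalDegree_zero_iff_isHomogeneous _).2 hp)

/-- The degree `n` part of the inverse of the intertwining operator, given by the recursion
`U_{n+1} q = (n+1)⁻¹ ∑_i x_i U_n (T_i q)` forced by Euler's identity. It is of interest only on
homogeneous polynomials of degree `n`. -/
def invIntertwinerAux (R : Finset (RSpace d)) (β : RSpace d) (k : RSpace d → ℂ) :
    ℕ → Poly d →ₗ[ℂ] Poly d
  | 0 => LinearMap.id
  | n + 1 => ((n + 1 : ℂ))⁻¹ • ∑ i, LinearMap.mulLeft ℂ (X i : Poly d) ∘ₗ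
      invIntertwinerAux R β k n ∘ₗ polyDunkl R β k (EuclideanSpace.single i 1)

theorem invIntertwinerAux_succ (n : ℕ) (q : Poly d) : invIntertwinerAux R β k (n + 1) q =
    ((n + 1 : ℂ))⁻¹ • ∑ i, X i *
      invIntertwinerAux R β k n (polyDunkl R β k (EuclideanSpace.single i 1) q) := by
  simp [invIntertwinerAux]

theorem isHomogeneous_invIntertwinerAux (hR : IsRootSystem R) :
    ∀ {n : ℕ} {q : Poly d}, q.IsHomogeneous n → (invIntertwinerAux R β k n q).IsHomogeneous n
  | 0, _, hq => hq
  | n + 1, q, hq => by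
    rw [invIntertwinerAux_succ, smul_eq_C_mul]
    refine (IsHomogeneous.sum _ _ _ fun i _ => ?_).C_mul _
    rw [add_comm]
    exact (isHomogeneous_X ℂ i).mul
      (isHomogeneous_invIntertwinerAux hR (isHomogeneous_polyDunkl hR _ hq))

/-- `∂_ξ U = U T_ξ`. By commutativity of the Dunkl operators the polynomials `U (T_i q)` form a
closed one-form, so that `U q` is its primitive. -/
theorem polyDeriv_invIntertwinerAux (hR : IsRootSystem R)
    (hβ : ∀ α ∈ R, (inner ℝ α β : ℝ) ≠ 0) (hk : IsParameter R k) (n : ℕ) :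
    ∀ (ξ : RSpace d) {q : Poly d}, q.IsHomogeneous (n + 1) →
      polyDeriv ξ (invIntertwinerAux R β k (n + 1) q) =
        invIntertwinerAux R β k n (polyDunkl R β k ξ q) := by
  induction n with
  | zero =>
    intro ξ q hq
    have h : ∀ i : Fin d, ∃ c, polyDunkl R β k (EuclideanSpace.single i 1) q = C c := fun i => by
      have h1 := isHomogeneous_polyDunkl (β := β) (k := k) hR (EuclideanSpace.single i 1) hq
      exact ⟨_, eq_C_of_isHomogeneous_zero h1⟩
    choose c hc using h
    rw [invIntertwinerAux_succ, polyDunkl_eq_sum]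
    simp only [invIntertwinerAux, LinearMap.id_apply, hc, Nat.cast_zero, zero_add, inv_one,
      one_smul]
    rw [← polyDerivₗ_apply, map_sum]
    simp only [polyDerivₗ_apply, polyDeriv_mul, polyDeriv_X, polyDeriv_C, mul_zero, add_zero,
      smul_eq_C_mul]
  | succ n ih =>
    intro ξ q hq
    set p : RSpace d → Poly d := fun η => invIntertwinerAux R β k (n + 1) (polyDunkl R β k η q)
      with hp
    have hsymm : ∀ ξ η, polyDeriv ξ (p η) = polyDeriv η (p ξ) := by
      intro ξ η
      simp only [hp]
      rw [ih ξ (isHomogeneous_polyDunkl hR _ hq), ih η (isHomogeneous_polyDunkl hR _ hq),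
        polyDunkl_comm hR hβ hk]
    have hsum : p ξ = ∑ i, C ((ξ i : ℝ) : ℂ) * p (EuclideanSpace.single i 1) := by
      simp only [hp]
      rw [polyDunkl_eq_sum, map_sum]
      simp only [map_smul, ← smul_eq_C_mul]
    have hhom : (p ξ).IsHomogeneous (n + 1) :=
      isHomogeneous_invIntertwinerAux hR (isHomogeneous_polyDunkl hR _ hq)
    have h1 : polyDeriv ξ (∑ i, X i * p (EuclideanSpace.single i 1)) =
        ((n + 1 : ℕ) + 1 : ℂ) • p ξ := by
      rw [← polyDerivₗ_apply, map_sum]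
      simp only [polyDerivₗ_apply, polyDeriv_mul, polyDeriv_X, hsymm ξ, polyDeriv_single]
      rw [Finset.sum_add_distrib, ← hsum, hhom.sum_X_mul_pderiv, ← Nat.cast_smul_eq_nsmul ℂ]
      module
    rw [invIntertwinerAux_succ, ← polyDerivₗ_apply, map_smul, polyDerivₗ_apply, h1, smul_smul,
      inv_mul_cancel₀ (Nat.cast_add_one_ne_zero (n + 1)), one_smul]

/-- Injectivity of `U_n`: if `U_{n+1} q = 0`, then all `U_n (T_i q)` vanish, and by induction all
`T_i q`. -/
theorem eq_zero_of_invIntertwinerAux_eq_zero (hR : IsRootSystem R)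
    (hβ : ∀ α ∈ R, (inner ℝ α β : ℝ) ≠ 0) (hk : IsParameter R k) (hkM : InMStar R β k) :
    ∀ {n : ℕ} {q : Poly d}, q.IsHomogeneous n → invIntertwinerAux R β k n q = 0 → q = 0
  | 0, _, _, h => h
  | n + 1, q, hq, h => by
    refine eq_of_polyDunkl_eq hR hkM hq (isHomogeneous_zero _ _ _) fun i => ?_
    rw [map_zero]
    refine eq_zero_of_invIntertwinerAux_eq_zero hR hβ hk hkM (isHomogeneous_polyDunkl hR _ hq) ?_
    rw [← polyDeriv_invIntertwinerAux hR hβ hk n _ hq, h, ← polyDerivₗ_apply, map_zero]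

/-- A family of linear automorphisms of the spaces of homogeneous polynomials glues to a linear
automorphism of the space of all polynomials. -/
def gradedEquiv (V : ∀ n, homogeneousSubmodule (Fin d) ℂ n ≃ₗ[ℂ] homogeneousSubmodule (Fin d) ℂ n) :
    Poly d ≃ₗ[ℂ] Poly d :=
  letI := decomposition (σ := Fin d) (R := ℂ)
  let e := DirectSum.decomposeLinearEquiv (homogeneousSubmodule (Fin d) ℂ)
  e ≪≫ₗ DFinsupp.mapRange.linearEquiv V ≪≫ₗ e.symm

theorem gradedEquiv_apply
    (V : ∀ n, homogeneousSubmodule (Fin d) ℂ n ≃ₗ[ℂ] homogeneousSubmodule (Fin d) ℂ n) {n : ℕ}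
    (p : homogeneousSubmodule (Fin d) ℂ n) : gradedEquiv V (p : Poly d) = V n p := by
  let _ := decomposition (σ := Fin d) (R := ℂ)
  simp only [gradedEquiv, LinearEquiv.trans_apply, DirectSum.decomposeLinearEquiv_apply,
    DirectSum.decompose_coe]
  rw [DFinsupp.mapRange.linearEquiv_apply]
  erw [DFinsupp.mapRange_single]
  exact DirectSum.decompose_symm_of _ _

theorem linearMap_eq_of_homogeneous {f g : Poly d →ₗ[ℂ] Poly d}
    (h : ∀ n p, p.IsHomogeneous n → f p = g p) (p : Poly d) : f p = g p := by
  rw [← sum_homogeneousComponent p, map_sum, map_sum]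
  exact Finset.sum_congr rfl fun n _ => h n _ (homogeneousComponent_isHomogeneous n p)

/-- The intertwining operator is the inverse of `U = ⨁ U_n`, which is bijective since it is injective
on the finite-dimensional spaces of homogeneous polynomials. -/
theorem exists_isIntertwiner (hR : IsRootSystem R)
    (hβ : ∀ α ∈ R, (inner ℝ α β : ℝ) ≠ 0) (hk : IsParameter R k) (hkM : InMStar R β k) :
    ∃ V, IsIntertwiner R β k V := by
  have hfd : ∀ n, Module.Finite ℂ (homogeneousSubmodule (Fin d) ℂ n) := fun n =>
    Module.Finite.iff_fg.2 (homogeneousSubmodule_fg _ _ n)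
  let u : ∀ n, homogeneousSubmodule (Fin d) ℂ n →ₗ[ℂ] homogeneousSubmodule (Fin d) ℂ n := fun n =>
    (invIntertwinerAux R β k n).restrict fun q hq => isHomogeneous_invIntertwinerAux hR hq
  have hu : ∀ n, Function.Injective (u n) := fun n => by
    rw [← LinearMap.ker_eq_bot, LinearMap.ker_eq_bot']
    intro q hq
    exact Subtype.ext (eq_zero_of_invIntertwinerAux_eq_zero hR hβ hk hkM q.2
      (congrArg Subtype.val hq))
  let U := gradedEquiv fun n => LinearEquiv.ofInjectiveEndo (u n) (hu n)
  have hU : ∀ {n : ℕ} {q : Poly d}, q.IsHomogeneous n → U q = invIntertwinerAux R β k n q :=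
    fun {n q} hq => gradedEquiv_apply _ ⟨q, hq⟩
  have hV : ∀ {n : ℕ} {p : Poly d}, p.IsHomogeneous n → (U.symm p).IsHomogeneous n := by
    intro n p hp
    obtain ⟨q, hq⟩ := (LinearEquiv.ofInjectiveEndo (u n) (hu n)).surjective ⟨p, hp⟩
    have h1 : U q = p := by
      rw [hU q.2]
      exact congrArg Subtype.val hq
    rw [← h1, LinearEquiv.symm_apply_apply]
    exact q.2
  refine ⟨U.symm, fun n p => hV, ?_, ?_⟩
  · rw [LinearEquiv.symm_apply_eq, hU (isHomogeneous_one _ _)]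
    rfl
  · intro ξ p x
    rw [dunklOp_polyFun hR]
    congr 1
    refine linearMap_eq_of_homogeneous (f := polyDunkl R β k ξ ∘ₗ U.symm.toLinearMap)
      (g := U.symm.toLinearMap ∘ₗ polyDerivₗ ξ) (fun n p hp => ?_) p |>.trans
        (by simp [polyDerivₗ_apply])
    simp only [LinearMap.comp_apply, LinearEquiv.coe_coe, polyDerivₗ_apply]
    rw [LinearEquiv.eq_symm_apply]
    cases n with
    | zero =>
      have h0 : ∀ {q : Poly d}, q.IsHomogeneous 0 → ∃ c, q = C c := fun hq =>
        ⟨_, eq_C_of_isHomogeneous_zero hq⟩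
      obtain ⟨b, hb⟩ := h0 hp
      obtain ⟨c, hc⟩ := h0 (hV hp)
      rw [hc, hb, polyDunkl_C hR, polyDeriv_C, map_zero]
    | succ n =>
      rw [hU (isHomogeneous_polyDunkl hR ξ (hV hp)),
        ← polyDeriv_invIntertwinerAux hR hβ hk n ξ (hV hp), ← hU (hV hp),
        LinearEquiv.apply_symm_apply]

theorem IsIntertwiner.polyDunkl_apply (hR : IsRootSystem R) {V : Poly d ≃ₗ[ℂ] Poly d}
    (hV : IsIntertwiner R β k V) (ξ : RSpace d) (p : Poly d) :
    polyDunkl R β k ξ (V p) = V (polyDeriv ξ p) :=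
  polyFun_injective <| funext fun x => by rw [← dunklOp_polyFun hR, hV.intertwines]

/-- Two intertwining operators agree in degree `n + 1` if they do in degree `n`, because the Dunkl
operators have no common kernel in degree `n + 1`. -/
theorem IsIntertwiner.unique (hR : IsRootSystem R) (hkM : InMStar R β k)
    {V W : Poly d ≃ₗ[ℂ] Poly d} (hV : IsIntertwiner R β k V) (hW : IsIntertwiner R β k W) :
    V = W := by
  have h : ∀ n p, p.IsHomogeneous n → V p = W p := by
    intro n
    induction n with
    | zero =>
      intro p hp
      have h0 : p = p.coeff 0 • 1 := by
        rw [smul_eq_C_mul, mul_one]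
        exact eq_C_of_isHomogeneous_zero hp
      rw [h0, map_smul, map_smul, hV.map_one, hW.map_one]
    | succ n ih =>
      intro p hp
      refine eq_of_polyDunkl_eq hR hkM (hV.map_homogeneous _ _ hp) (hW.map_homogeneous _ _ hp)
        fun i => ?_
      rw [hV.polyDunkl_apply hR, hW.polyDunkl_apply hR, ih _ (isHomogeneous_polyDeriv _ hp)]
  exact LinearEquiv.ext fun p =>
    linearMap_eq_of_homogeneous (f := V.toLinearMap) (g := W.toLinearMap) h p

theorem isIntertwiner_intertwiner (hR : IsRootSystem R)
    (hβ : ∀ α ∈ R, (inner ℝ α β : ℝ) ≠ 0) (hk : IsParameter R k) (hkM : InMStar R β k) :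
    IsIntertwiner R β k (intertwiner R β k) :=
  Classical.epsilon_spec (exists_isIntertwiner hR hβ hk hkM)

/-! ### Holomorphic functions of several variables -/

/-- Cauchy's estimate for the Fréchet derivative. -/
theorem norm_fderiv_le_of_norm_le_closedBall {E : Type*} [NormedAddCommGroup E] [NormedSpace ℂ E]
    {F : E → ℂ} (hF : Differentiable ℂ F) {x : E} {M : ℝ}
    (hM : ∀ y ∈ Metric.closedBall x 1, ‖F y‖ ≤ M) : ‖fderiv ℂ F x‖ ≤ M := by
  have hM0 : 0 ≤ M := (norm_nonneg _).trans (hM x (by simp))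
  refine ContinuousLinearMap.opNorm_le_bound _ hM0 fun v => ?_
  rcases eq_or_ne v 0 with rfl | hv
  · simp
  have hv' : 0 < ‖v‖ := norm_pos_iff.2 hv
  have hd : Differentiable ℂ fun t : ℂ => F (x + t • v) :=
    hF.comp ((differentiable_const _).add (differentiable_id.smul_const v))
  have h1 : HasDerivAt (fun t : ℂ => x + t • v) v 0 := by
    simpa using ((hasDerivAt_id (0 : ℂ)).smul_const v).const_add x
  have h2 : HasDerivAt (fun t : ℂ => F (x + t • v)) (fderiv ℂ F x v) 0 := by
    refine HasFDerivAt.comp_hasDerivAt (0 : ℂ) ?_ h1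
    simpa using (hF x).hasFDerivAt
  rw [← h2.deriv]
  have h3 := Complex.norm_deriv_le_of_forall_mem_sphere_norm_le (c := 0) (inv_pos.2 hv')
    hd.diffContOnCl (C := M) fun t ht => hM _ ?_
  · simpa using h3
  · rw [mem_sphere_zero_iff_norm] at ht
    simp [norm_smul, ht, hv'.ne']

/-- The directional derivatives of a holomorphic function are holomorphic, since they are given by
Cauchy integrals depending holomorphically on a parameter. -/
theorem differentiable_fderiv_apply {F : CSpace d → ℂ} (hF : Differentiable ℂ F) (v : CSpace d) :
    Differentiable ℂ fun x => fderiv ℂ F x v := by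
  have hrep : ∀ x, fderiv ℂ F x v = (2 * Real.pi * Complex.I : ℂ)⁻¹ *
      ∮ z in C(0, 1), ((z - 0) ^ 2)⁻¹ • F (x + z • v) := by
    intro x
    have hd : Differentiable ℂ fun t : ℂ => F (x + t • v) :=
      hF.comp ((differentiable_const _).add (differentiable_id.smul_const v))
    have h1 : HasDerivAt (fun t : ℂ => x + t • v) v 0 := by
      simpa using ((hasDerivAt_id (0 : ℂ)).smul_const v).const_add x
    have h2 : HasDerivAt (fun t : ℂ => F (x + t • v)) (fderiv ℂ F x v) 0 := by
      refine HasFDerivAt.comp_hasDerivAt (0 : ℂ) ?_ h1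
      simpa using (hF x).hasFDerivAt
    rw [← smul_eq_mul, Complex.two_pi_I_inv_smul_circleIntegral_sub_sq_inv_smul_of_differentiable
      isOpen_univ (Set.subset_univ _) hd.differentiableOn (by simp), h2.deriv]
  have hFc := hF.continuous
  intro x₀
  rw [funext hrep]
  refine DifferentiableAt.const_mul ?_ _
  obtain ⟨M, hM⟩ := (isCompact_closedBall x₀ (2 + ‖v‖)).exists_bound_of_continuousOn hFc.continuousOn
  simp only [circleIntegral]
  have hnorm : ∀ θ : ℝ, ‖deriv (circleMap 0 1) θ * ((circleMap 0 1 θ - 0) ^ 2)⁻¹‖ = 1 := by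
    intro θ
    simp [norm_circleMap_zero]
  have hcont : Continuous fun θ : ℝ => deriv (circleMap 0 1) θ * ((circleMap 0 1 θ - 0) ^ 2)⁻¹ := by
    simp only [deriv_circleMap]
    refine ((continuous_circleMap 0 1).mul continuous_const).mul (Continuous.inv₀ (by fun_prop) ?_)
    intro θ
    simp [circleMap]
  have hmeas : MeasureTheory.StronglyMeasurable (fderiv ℂ F) :=
    (measurable_fderiv ℂ F).stronglyMeasurable
  refine (intervalIntegral.hasFDerivAt_integral_of_dominated_of_fderiv_le
    (F' := fun x θ => (deriv (circleMap 0 1) θ * ((circleMap 0 1 θ - 0) ^ 2)⁻¹) •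
      fderiv ℂ F (x + circleMap 0 1 θ • v)) (bound := fun _ => M)
    (Metric.ball_mem_nhds x₀ one_pos) ?_ ?_ ?_ ?_ ?_ ?_).differentiableAt
  · refine Filter.Eventually.of_forall fun x => Continuous.aestronglyMeasurable ?_
    simp only [smul_eq_mul, ← mul_assoc]
    exact hcont.mul (hFc.comp (continuous_const.add ((continuous_circleMap 0 1).smul continuous_const)))
  · refine Continuous.intervalIntegrable ?_ _ _
    simp only [smul_eq_mul, ← mul_assoc]
    exact hcont.mul (hFc.comp (continuous_const.add ((continuous_circleMap 0 1).smul continuous_const)))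
  · exact hcont.aestronglyMeasurable.smul
      (hmeas.comp_measurable (by fun_prop : Continuous _).measurable).aestronglyMeasurable
  · refine Filter.Eventually.of_forall fun θ _ x hx => ?_
    rw [norm_smul, hnorm, one_mul]
    refine norm_fderiv_le_of_norm_le_closedBall hF fun y hy => hM y ?_
    rw [Metric.mem_closedBall] at hy ⊢
    rw [Metric.mem_ball] at hx
    have h1 : dist (x + circleMap 0 1 θ • v) x = ‖v‖ := by
      rw [dist_eq_norm, add_sub_cancel_left, norm_smul, norm_circleMap_zero]
      simp
    linarith [dist_triangle y (x + circleMap 0 1 θ • v) x₀,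
      dist_triangle (x + circleMap 0 1 θ • v) x x₀]
  · exact intervalIntegrable_const
  · refine Filter.Eventually.of_forall fun θ _ x _ => ?_
    simp only [smul_eq_mul, ← mul_assoc]
    refine HasFDerivAt.const_mul ?_ _
    have h1 : HasFDerivAt (fun x : CSpace d => x + circleMap 0 1 θ • v)
      (ContinuousLinearMap.id ℂ (CSpace d)) x := (hasFDerivAt_id x).add_const _
    exact (hF _).hasFDerivAt.comp x h1

theorem clm_apply_eq_sum (L : CSpace d →L[ℂ] ℂ) (x : CSpace d) :
    L x = ∑ i, x i * L (Pi.single i 1) := by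
  conv_lhs => rw [← Finset.univ_sum_single x]
  rw [map_sum]
  refine Finset.sum_congr rfl fun i _ => ?_
  rw [← smul_eq_mul, ← map_smul, ← Pi.single_smul', smul_eq_mul, mul_one]

/-- The Taylor coefficients along lines through `0` of a holomorphic function on `ℂ^d` are
homogeneous polynomials in the direction of the line. -/
theorem exists_isHomogeneous_iteratedDeriv (n : ℕ) : ∀ {F : CSpace d → ℂ}, Differentiable ℂ F →
    ∃ p : Poly d, p.IsHomogeneous n ∧
      ∀ x, iteratedDeriv n (fun t : ℂ => F (t • x)) 0 = eval x p := by
  induction n with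
  | zero =>
    intro F _
    exact ⟨C (F 0), isHomogeneous_C _ _, fun x => by simp⟩
  | succ n ih =>
    intro F hF
    choose p hp hpF using fun i : Fin d => ih (differentiable_fderiv_apply hF (Pi.single i 1))
    refine ⟨∑ i, X i * p i, IsHomogeneous.sum _ _ _ fun i _ => ?_, fun x => ?_⟩
    · rw [add_comm]
      exact (isHomogeneous_X ℂ i).mul (hp i)
    · have hline : ∀ t : ℂ, HasDerivAt (fun t : ℂ => t • x) x t := fun t => by
        simpa using (hasDerivAt_id t).smul_const x
      have hderiv : deriv (fun t : ℂ => F (t • x)) = fun t =>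
          ∑ i, x i * fderiv ℂ F (t • x) (Pi.single i 1) := by
        funext t
        rw [← clm_apply_eq_sum]
        exact ((hF _).hasFDerivAt.comp_hasDerivAt t (hline t)).deriv
      have hsm : ∀ i, ContDiff ℂ n fun t : ℂ => fderiv ℂ F (t • x) (Pi.single i 1) := fun i =>
        Differentiable.contDiff ((differentiable_fderiv_apply hF (Pi.single i 1)).comp
          fun t => (hline t).differentiableAt)
      rw [iteratedDeriv_succ', hderiv, iteratedDeriv_fun_sum]
      · simp only [map_sum, map_mul, eval_X, ← hpF]
        refine Finset.sum_congr rfl fun i _ => ?_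
        exact iteratedDeriv_const_mul_field _ _
      · exact fun i _ => contDiffAt_const.mul (hsm i).contDiffAt

theorem exists_eq_toC_add_I_smul (x : CSpace d) :
    ∃ a b : RSpace d, x = toC a + Complex.I • toC b := by
  refine ⟨WithLp.toLp 2 fun i => (x i).re, WithLp.toLp 2 fun i => (x i).im, ?_⟩
  funext i
  simp [toC, mul_comm Complex.I, Complex.re_add_im]

/-- A holomorphic function on `ℂ^d` that vanishes on `ℝ^d` vanishes identically. -/
theorem eq_zero_of_forall_toC {F : CSpace d → ℂ} (hF : Differentiable ℂ F)
    (h : ∀ x : RSpace d, F (toC x) = 0) (x : CSpace d) : F x = 0 := by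
  obtain ⟨a, b, hx⟩ := exists_eq_toC_add_I_smul x
  have hd : Differentiable ℂ fun t : ℂ => F (toC a + t • toC b) :=
    hF.comp ((differentiable_const _).add (differentiable_id.smul_const _))
  -- the restriction to the complex line spanned by `b` through `a` vanishes at the real points
  have hreal : ∀ t : ℝ, F (toC a + (t : ℂ) • toC b) = 0 := fun t => by
    rw [← toC_smul]
    have : toC a + toC (t • b) = toC (a + t • b) := by
      funext i
      simp [toC]
    rw [this, h]
  have hfreq : ∃ᶠ t in nhdsWithin (0 : ℂ) {0}ᶜ, F (toC a + t • toC b) = 0 := by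
    have htend : Filter.Tendsto (fun t : ℝ => (t : ℂ)) (nhdsWithin 0 {0}ᶜ)
        (nhdsWithin (0 : ℂ) {0}ᶜ) := by
      refine tendsto_nhdsWithin_iff.2 ⟨?_, ?_⟩
      · exact (Complex.continuous_ofReal.tendsto' 0 0 (by simp)).mono_left nhdsWithin_le_nhds
      · filter_upwards [self_mem_nhdsWithin] with t ht
        simpa using ht
    exact htend.frequently (Filter.Eventually.of_forall hreal).frequently
  have hana : AnalyticOnNhd ℂ (fun t : ℂ => F (toC a + t • toC b)) Set.univ :=
    hd.differentiableOn.analyticOnNhd isOpen_univ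
  have hz := hana.eqOn_zero_of_preconnected_of_frequently_eq_zero isPreconnected_univ
    (Set.mem_univ 0) hfreq
  rw [hx]
  exact hz (Set.mem_univ Complex.I)

/-! ### Complexified reflections -/

/-- The complex linear extension to `ℂ^d` of the reflection `σ_α`. -/
def reflC (α : RSpace d) (x : CSpace d) : CSpace d :=
  x - (2 * pairing x (toC α) / ((‖α‖ : ℝ) : ℂ) ^ 2) • toC α

theorem reflC_toC (α x : RSpace d) : reflC α (toC x) = toC (refl α x) := by
  funext i
  simp [reflC, refl_apply, pairing_toC, toC]

theorem reflC_smul (α : RSpace d) (c : ℂ) (x : CSpace d) : reflC α (c • x) = c • reflC α x := by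
  have h : pairing (c • x) (toC α) = c * pairing x (toC α) := by
    simp [pairing, Finset.mul_sum, mul_assoc]
  rw [reflC, reflC, h, smul_sub, smul_smul]
  congr 2
  ring

theorem differentiable_pairing_const (y : CSpace d) :
    Differentiable ℂ fun x : CSpace d => pairing x y := by
  unfold pairing
  fun_prop

theorem differentiable_reflC (α : RSpace d) : Differentiable ℂ (reflC α) := by
  have := differentiable_pairing_const (toC α)
  unfold reflC
  fun_prop

theorem differentiable_eval (p : Poly d) : Differentiable ℂ fun x : CSpace d => eval x p :=
  fun x => (hasFDerivAt_eval p x).differentiableAt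

/-- The action of `σ_α` on polynomials is given on all of `ℂ^d` by the complexified reflection, since
both sides are holomorphic and agree on `ℝ^d`. -/
theorem eval_polyAct_refl (α : RSpace d) (p : Poly d) (x : CSpace d) :
    eval x (polyAct (refl α) p) = eval (reflC α x) p := by
  rw [← sub_eq_zero]
  refine eq_zero_of_forall_toC (F := fun x => eval x (polyAct (refl α) p) - eval (reflC α x) p)
    ((differentiable_eval _).sub ((differentiable_eval p).comp (differentiable_reflC α)))
    (fun x => ?_) x
  rw [reflC_toC, sub_eq_zero]
  exact polyFun_polyAct _ _ _

theorem eval_opW (n : ℕ) (p : Poly d) (x : CSpace d) : eval x (opW R β k n p) =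
    n * eval x p + ∑ α ∈ posRoots R β, k α * (eval x p - eval (reflC α x) p) := by
  rw [opW_apply]
  simp only [map_sub, smul_eval, map_sum, eval_polyAct_refl, mul_sub, Finset.sum_sub_distrib,
    ← Finset.sum_mul]
  ring

/-- This holds for every function `f`, also on the hyperplane, where both sides are `0`. -/
theorem inner_mul_diffQuot (α : RSpace d) (f : RSpace d → ℂ) (x : RSpace d) :
    ((inner ℝ α x : ℝ) : ℂ) * diffQuot α f x = f x - f (refl α x) := by
  rw [diffQuot]
  split_ifs with h
  · have hx : refl α x = x := by
      rw [refl_apply, real_inner_comm, h]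
      simp
    rw [h, hx]
    simp
  · rw [mul_div_cancel₀]
    exact_mod_cast h

/-! ### Uniqueness of the Dunkl kernel -/

theorem iteratedDeriv_succ_id_mul (n : ℕ) : ∀ {ψ : ℂ → ℂ}, Differentiable ℂ ψ →
    iteratedDeriv (n + 1) (fun t => t * ψ t) 0 = (n + 1) * iteratedDeriv n ψ 0 := by
  induction n with
  | zero =>
    intro ψ hψ
    have h : HasDerivAt (fun t => t * ψ t) (1 * ψ 0 + 0 * deriv ψ 0) 0 :=
      (hasDerivAt_id (0 : ℂ)).mul (hψ 0).hasDerivAt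
    simp [h.deriv]
  | succ n ih =>
    intro ψ hψ
    have hψ' : Differentiable ℂ (deriv ψ) := hψ.deriv
    have h : deriv (fun t => t * ψ t) = fun t => ψ t + t * deriv ψ t := by
      funext t
      have h : HasDerivAt (fun t => t * ψ t) (1 * ψ t + t * deriv ψ t) t :=
        (hasDerivAt_id t).mul (hψ t).hasDerivAt
      rw [h.deriv, one_mul]
    rw [iteratedDeriv_succ', h, iteratedDeriv_fun_add hψ.contDiff.contDiffAt
      (differentiable_fun_id.fun_mul hψ').contDiff.contDiffAt, ih hψ', ← iteratedDeriv_succ']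
    push_cast
    ring

/-- The Euler form of the joint eigenvalue equation of the Dunkl operators, extended to `ℂ^d`. -/
theorem euler_equation {F : CSpace d → ℂ} (hF : Differentiable ℂ F) {y : RSpace d}
    (h : ∀ ξ x : RSpace d, dunklOp R β k ξ (fun u => F (toC u)) x =
      ((inner ℝ ξ y : ℝ) : ℂ) * F (toC x)) (x : CSpace d) :
    fderiv ℂ F x x + ∑ α ∈ posRoots R β, k α * (F x - F (reflC α x)) =
      pairing x (toC y) * F x := by
  rw [← sub_eq_zero]
  refine eq_zero_of_forall_toC (F := fun x => fderiv ℂ F x x +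
    ∑ α ∈ posRoots R β, k α * (F x - F (reflC α x)) - pairing x (toC y) * F x) ?_ (fun x => ?_) x
  · have h1 : Differentiable ℂ fun x => fderiv ℂ F x x := by
      simp_rw [fun x => clm_apply_eq_sum (fderiv ℂ F x) x]
      exact Differentiable.fun_sum fun i _ =>
        (differentiable_apply i).mul (differentiable_fderiv_apply hF _)
    exact (h1.add (Differentiable.fun_sum fun α _ => (hF.sub
      (hF.comp (differentiable_reflC α))).const_mul (k α))).sub
        ((differentiable_pairing_const _).mul hF)
  · have h2 := h x x
    rw [dunklOp, (hasFDerivAt_comp_toC (hF (toC x)).hasFDerivAt).fderiv] at h2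
    simp only [mul_assoc, inner_mul_diffQuot] at h2
    simp only [reflC_toC, pairing_toC]
    rw [sub_eq_zero, ← h2]
    rfl

theorem IsDunklKernel.differentiable_left {E : CSpace d → CSpace d → ℂ}
    (hE : IsDunklKernel R β k E) (y : CSpace d) : Differentiable ℂ fun x => E x y :=
  hE.holomorphic.comp (f := fun x => (x, y)) (by fun_prop)

theorem IsDunklKernel.differentiable_right {E : CSpace d → CSpace d → ℂ}
    (hE : IsDunklKernel R β k E) (x : CSpace d) : Differentiable ℂ fun y => E x y :=
  hE.holomorphic.comp (f := fun y => (x, y)) (by fun_prop)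

/-- The homogeneous Taylor polynomials `p_n` at `0` of a joint eigenfunction satisfy
`W_n p_n = n ⟨·,y⟩ p_{n-1}` (they are not divided by `n!`). -/
theorem exists_taylor_recursion {F : CSpace d → ℂ} (hF : Differentiable ℂ F) {y : RSpace d}
    (h : ∀ ξ x : RSpace d, dunklOp R β k ξ (fun u => F (toC u)) x =
      ((inner ℝ ξ y : ℝ) : ℂ) * F (toC x)) :
    ∃ p : ℕ → Poly d, (∀ n, (p n).IsHomogeneous n) ∧
      (∀ n x, iteratedDeriv n (fun t : ℂ => F (t • x)) 0 = eval x (p n)) ∧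
      ∀ n, opW R β k (n + 1) (p (n + 1)) = C ((n : ℂ) + 1) * (linForm (toC y) * p n) := by
  choose p hp hpF using fun n => exists_isHomogeneous_iteratedDeriv n hF
  refine ⟨p, hp, hpF, fun n => MvPolynomial.funext fun x => ?_⟩
  have hφ : ∀ x : CSpace d, Differentiable ℂ fun t : ℂ => F (t • x) := fun x =>
    hF.comp (differentiable_id.smul_const x)
  have hφ' : ∀ t : ℂ, HasDerivAt (fun t : ℂ => F (t • x)) (fderiv ℂ F (t • x) x) t := fun t =>
    (hF _).hasFDerivAt.comp_hasDerivAt t (by simpa using (hasDerivAt_id t).smul_const x)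
  -- the Euler equation along the line through `x`
  have hline : (fun t : ℂ => t * deriv (fun t : ℂ => F (t • x)) t) = fun t =>
      t * (pairing x (toC y) * F (t • x)) -
        ∑ α ∈ posRoots R β, k α * (F (t • x) - F (t • reflC α x)) := by
    funext t
    have h1 := euler_equation hF h (t • x)
    have h2 : pairing (t • x) (toC y) = t * pairing x (toC y) := by
      simp [pairing, Finset.mul_sum, mul_assoc]
    simp only [reflC_smul, h2, map_smul, smul_eq_mul] at h1
    rw [(hφ' t).deriv]
    linear_combination h1
  have hcd : ∀ {ψ : ℂ → ℂ}, Differentiable ℂ ψ → ContDiffAt ℂ (n + 1 : ℕ) ψ 0 := fun hψ =>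
    hψ.contDiff.contDiffAt
  have h3 := congrArg (iteratedDeriv (n + 1) · 0) hline
  beta_reduce at h3
  rw [iteratedDeriv_succ_id_mul n (hφ x).deriv, ← iteratedDeriv_succ', iteratedDeriv_fun_sub,
    iteratedDeriv_succ_id_mul n ((hφ x).const_mul _), iteratedDeriv_const_mul_field,
    iteratedDeriv_fun_sum] at h3
  · have h4 : ∀ α ∈ posRoots R β, iteratedDeriv (n + 1)
        (fun t : ℂ => k α * (F (t • x) - F (t • reflC α x))) 0 =
        k α * (eval x (p (n + 1)) - eval (reflC α x) (p (n + 1))) := fun α _ => by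
      rw [iteratedDeriv_const_mul_field, iteratedDeriv_fun_sub (hcd (hφ x)) (hcd (hφ _)), hpF, hpF]
    rw [Finset.sum_congr rfl h4, hpF, hpF] at h3
    rw [eval_opW, map_mul, map_mul, eval_C, eval_linForm]
    push_cast
    linear_combination h3
  · exact fun α _ => hcd (((hφ x).sub (hφ _)).const_mul _)
  · exact hcd (differentiable_fun_id.fun_mul ((hφ x).const_mul _))
  · exact hcd (Differentiable.fun_sum fun α _ => ((hφ x).sub (hφ _)).const_mul _)

/-- By invertibility of the `W_n` the Taylor recursion determines the Taylor polynomials in `x` of a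
Dunkl kernel at every real `y`; holomorphy in `y` then gives all complex `y`. -/
theorem IsDunklKernel.unique (hkM : InMStar R β k) {E₁ E₂ : CSpace d → CSpace d → ℂ}
    (h₁ : IsDunklKernel R β k E₁) (h₂ : IsDunklKernel R β k E₂) : E₁ = E₂ := by
  have hreal : ∀ (x : CSpace d) (y : RSpace d), E₁ x (toC y) = E₂ x (toC y) := by
    intro x y
    obtain ⟨p, hp, hpF, hprec⟩ := exists_taylor_recursion (h₁.differentiable_left (toC y))
      fun ξ x => h₁.eigen y ξ x
    obtain ⟨q, hq, hqF, hqrec⟩ := exists_taylor_recursion (h₂.differentiable_left (toC y))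
      fun ξ x => h₂.eigen y ξ x
    have hpq : ∀ n, p n = q n := by
      intro n
      induction n with
      | zero =>
        refine MvPolynomial.funext fun x => ?_
        rw [← hpF, ← hqF]
        simp [h₁.map_zero, h₂.map_zero]
      | succ n ih =>
        refine (hkM (n + 1) (by omega)).injOn (hp _) (hq _) ?_
        rw [hprec, hqrec, ih]
    have hφ : ∀ {E : CSpace d → CSpace d → ℂ}, IsDunklKernel R β k E →
        Differentiable ℂ fun t : ℂ => E (t • x) (toC y) := fun hE =>
      (hE.differentiable_left (toC y)).comp (differentiable_id.smul_const x)
    have e₁ := Complex.taylorSeries_eq_of_entire (hφ h₁) 0 1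
    have e₂ := Complex.taylorSeries_eq_of_entire (hφ h₂) 0 1
    simp only [hpF, hqF, hpq, one_smul] at e₁ e₂
    exact e₁.symm.trans e₂
  funext x y
  rw [← sub_eq_zero]
  exact eq_zero_of_forall_toC (F := fun y => E₁ x y - E₂ x y)
    ((h₁.differentiable_right x).sub (h₂.differentiable_right x))
    (fun y => sub_eq_zero.2 (hreal x y)) y

/-! ### The Hermitian norm on `ℂ^d` -/

/-- The Hermitian norm on `ℂ^d`; it is invariant under the complexified reflections, contrary to the
supremum norm carried by the type `Fin d → ℂ`. -/
def hnorm (x : CSpace d) : ℝ := ‖(WithLp.toLp 2 x : EuclideanSpace ℂ (Fin d))‖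

theorem hnorm_nonneg (x : CSpace d) : 0 ≤ hnorm x := norm_nonneg _

theorem hnorm_sq (x : CSpace d) : hnorm x ^ 2 = ∑ i, ‖x i‖ ^ 2 := by
  rw [hnorm, EuclideanSpace.norm_sq_eq]

theorem hnorm_smul (c : ℂ) (x : CSpace d) : hnorm (c • x) = ‖c‖ * hnorm x := by
  rw [hnorm, hnorm, WithLp.toLp_smul, norm_smul]

theorem hnorm_add_le (x y : CSpace d) : hnorm (x + y) ≤ hnorm x + hnorm y := by
  rw [hnorm, WithLp.toLp_add]
  exact norm_add_le _ _

theorem hnorm_eq_zero {x : CSpace d} : hnorm x = 0 ↔ x = 0 := by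
  rw [hnorm, norm_eq_zero, WithLp.toLp_eq_zero]

theorem hnorm_toC (x : RSpace d) : hnorm (toC x) = ‖x‖ := by
  refine (sq_eq_sq₀ (hnorm_nonneg _) (norm_nonneg _)).1 ?_
  rw [hnorm_sq, EuclideanSpace.norm_sq_eq]
  simp [toC]

theorem norm_apply_le_hnorm (x : CSpace d) (i : Fin d) : ‖x i‖ ≤ hnorm x :=
  PiLp.norm_apply_le (WithLp.toLp 2 x : EuclideanSpace ℂ (Fin d)) i

theorem hnorm_le (x : CSpace d) : hnorm x ≤ d * ‖x‖ := by
  have h1 : hnorm x ≤ ∑ i : Fin d, ‖x i‖ := by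
    refine abs_le_of_sq_le_sq' ?_ (Finset.sum_nonneg fun i _ => norm_nonneg _) |>.2
    rw [hnorm_sq]
    exact Finset.sum_sq_le_sq_sum_of_nonneg fun i _ => norm_nonneg _
  refine h1.trans ?_
  calc ∑ i : Fin d, ‖x i‖ ≤ ∑ _i : Fin d, ‖x‖ := Finset.sum_le_sum fun i _ => norm_le_pi_norm x i
    _ = d * ‖x‖ := by simp

theorem norm_pairing_le (x y : CSpace d) : ‖pairing x y‖ ≤ hnorm x * hnorm y := by
  calc ‖pairing x y‖ ≤ ∑ i, ‖x i‖ * ‖y i‖ := by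
        refine (norm_sum_le _ _).trans_eq ?_
        simp only [norm_mul]
    _ ≤ √(∑ i, ‖x i‖ ^ 2) * √(∑ i, ‖y i‖ ^ 2) := Real.sum_mul_le_sqrt_mul_sqrt _ _ _
    _ = hnorm x * hnorm y := by
        rw [← hnorm_sq, ← hnorm_sq, Real.sqrt_sq (hnorm_nonneg _), Real.sqrt_sq (hnorm_nonneg _)]

theorem hnorm_toC_add_I_smul (a b : RSpace d) :
    hnorm (toC a + Complex.I • toC b) ^ 2 = ‖a‖ ^ 2 + ‖b‖ ^ 2 := by
  rw [hnorm_sq, EuclideanSpace.norm_sq_eq, EuclideanSpace.norm_sq_eq, ← Finset.sum_add_distrib]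
  refine Finset.sum_congr rfl fun i _ => ?_
  rw [← Complex.normSq_eq_norm_sq, Complex.normSq_apply]
  simp [toC, sq]

theorem hnorm_reflC (α : RSpace d) (x : CSpace d) : hnorm (reflC α x) = hnorm x := by
  obtain ⟨a, b, rfl⟩ := exists_eq_toC_add_I_smul x
  have h : reflC α (toC a + Complex.I • toC b) =
      toC (refl α a) + Complex.I • toC (refl α b) := by
    rw [← reflC_toC, ← reflC_toC, ← reflC_smul]
    have h1 : pairing (toC a + Complex.I • toC b) (toC α) =
        pairing (toC a) (toC α) + pairing (Complex.I • toC b) (toC α) := by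
      simp [pairing, add_mul, Finset.sum_add_distrib]
    rw [reflC, reflC, reflC, h1, mul_add, add_div, add_smul]
    abel
  refine (sq_eq_sq₀ (hnorm_nonneg _) (hnorm_nonneg _)).1 ?_
  rw [h, hnorm_toC_add_I_smul, hnorm_toC_add_I_smul, LinearIsometryEquiv.norm_map,
    LinearIsometryEquiv.norm_map]

/-! ### The homogeneous components of the Dunkl kernel -/

/-- `E_n(·, y)` as a polynomial. -/
def kernelPoly (R : Finset (RSpace d)) (β : RSpace d) (k : RSpace d → ℂ) (n : ℕ) (y : CSpace d) :
    Poly d :=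
  (n.factorial : ℂ)⁻¹ • intertwiner R β k (linForm y ^ n)

theorem eval_kernelPoly (n : ℕ) (x y : CSpace d) :
    eval x (kernelPoly R β k n y) = kernelE R β k n x y := by
  rw [kernelPoly, smul_eval, kernelE]

/-- `E_n(x, ·)` as a polynomial. -/
def kernelPolyRight (R : Finset (RSpace d)) (β : RSpace d) (k : RSpace d → ℂ) (n : ℕ)
    (x : CSpace d) : Poly d :=
  ∑ s ∈ Finset.piAntidiag Finset.univ n, C ((n.factorial : ℂ)⁻¹ *
    (Nat.multinomial Finset.univ s * eval x (intertwiner R β k (∏ i, X i ^ s i)))) * ∏ i, X i ^ s i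

theorem eval_kernelPolyRight (n : ℕ) (x y : CSpace d) :
    eval y (kernelPolyRight R β k n x) = kernelE R β k n x y := by
  have h : linForm y ^ n = ∑ s ∈ Finset.piAntidiag Finset.univ n,
      (Nat.multinomial Finset.univ s * ∏ i, y i ^ s i : ℂ) • ∏ i, (X i : Poly d) ^ s i := by
    rw [linForm, Finset.sum_pow_eq_sum_piAntidiag]
    refine Finset.sum_congr rfl fun s _ => ?_
    simp only [mul_pow, Finset.prod_mul_distrib, smul_eq_C_mul, map_mul, map_prod, map_pow,
      map_natCast]
    ring
  rw [kernelE, h, kernelPolyRight]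
  simp only [map_sum, map_smul, smul_eval, map_mul, eval_C, map_prod, map_pow, eval_X,
    Finset.mul_sum]
  exact Finset.sum_congr rfl fun s _ => by ring

theorem differentiable_kernelE (n : ℕ) :
    Differentiable ℂ fun q : CSpace d × CSpace d => kernelE R β k n q.1 q.2 := by
  simp only [← eval_kernelPolyRight, kernelPolyRight, map_sum, map_mul, eval_C, map_prod, map_pow,
    eval_X]
  have h : ∀ p : Poly d, Differentiable ℂ fun q : CSpace d × CSpace d => eval q.1 p := fun p =>
    (differentiable_eval p).comp differentiable_fst
  refine Differentiable.fun_sum fun s _ => (((h _).const_mul _).const_mul _).mul ?_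
  have h2 : (fun q : CSpace d × CSpace d => ∏ i, q.2 i ^ s i) =
      fun q => eval q.2 (∏ i, (X i : Poly d) ^ s i) := by simp
  rw [h2]
  exact (differentiable_eval _).comp differentiable_snd

theorem eval_smul_of_isHomogeneous {n : ℕ} {p : Poly d} (hp : p.IsHomogeneous n) (c : ℂ)
    (x : CSpace d) : eval (c • x) p = c ^ n * eval x p := by
  rw [eval_eq, eval_eq, Finset.mul_sum]
  refine Finset.sum_congr rfl fun s hs => ?_
  have h1 := hp.degree_eq_sum_deg_support hs
  have h2 : ∏ i ∈ s.support, (c • x) i ^ s i = c ^ n * ∏ i ∈ s.support, x i ^ s i := by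
    simp only [Pi.smul_apply, smul_eq_mul, mul_pow, Finset.prod_mul_distrib,
      Finset.prod_pow_eq_pow_sum]
    rw [h1]
  rw [h2]
  ring

theorem kernelE_smul_left (hV : IsIntertwiner R β k (intertwiner R β k)) (n : ℕ) (c : ℂ)
    (x y : CSpace d) : kernelE R β k n (c • x) y = c ^ n * kernelE R β k n x y := by
  have h : (linForm y ^ n).IsHomogeneous n := by
    simpa using (isHomogeneous_linForm y).pow n
  rw [kernelE, eval_smul_of_isHomogeneous (hV.map_homogeneous n _ h), kernelE]
  ring

theorem kernelE_smul_right (n : ℕ) (c : ℂ) (x y : CSpace d) :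
    kernelE R β k n x (c • y) = c ^ n * kernelE R β k n x y := by
  rw [kernelE, linForm_smul, mul_pow, ← map_pow, ← smul_eq_C_mul, map_smul, smul_eval, kernelE]
  ring

theorem kernelE_zero (hV : IsIntertwiner R β k (intertwiner R β k)) (x y : CSpace d) :
    kernelE R β k 0 x y = 1 := by
  simp [kernelE, hV.map_one]

theorem polyDeriv_pow (ξ : RSpace d) (p : Poly d) (n : ℕ) :
    polyDeriv ξ (p ^ (n + 1)) = ((n : ℂ) + 1) • (polyDeriv ξ p * p ^ n) := by
  induction n with
  | zero => simp
  | succ n ih =>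
    rw [pow_succ, polyDeriv_mul, ih]
    simp only [smul_eq_C_mul, map_add, map_one, Nat.cast_add, Nat.cast_one]
    ring

/-- `T_ξ E_{n+1}(·, y) = ⟨ξ, y⟩ E_n(·, y)`. -/
theorem polyDunkl_kernelPoly (hR : IsRootSystem R)
    (hV : IsIntertwiner R β k (intertwiner R β k)) (n : ℕ) (ξ : RSpace d) (y : CSpace d) :
    polyDunkl R β k ξ (kernelPoly R β k (n + 1) y) =
      pairing (toC ξ) y • kernelPoly R β k n y := by
  rw [kernelPoly, map_smul, hV.polyDunkl_apply hR, polyDeriv_pow, polyDeriv_linForm, kernelPoly,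
    ← smul_eq_C_mul, map_smul, map_smul, smul_smul, smul_smul, smul_smul, Nat.factorial_succ]
  congr 1
  have h1 : ((n : ℂ) + 1) ≠ 0 := Nat.cast_add_one_ne_zero n
  have h2 : (n.factorial : ℂ) ≠ 0 := by exact_mod_cast n.factorial_ne_zero
  push_cast
  field_simp

theorem isHomogeneous_kernelPoly (hV : IsIntertwiner R β k (intertwiner R β k)) (n : ℕ)
    (y : CSpace d) : (kernelPoly R β k n y).IsHomogeneous n := by
  rw [kernelPoly, smul_eq_C_mul]
  refine (hV.map_homogeneous n _ ?_).C_mul _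
  simpa using (isHomogeneous_linForm y).pow n

/-- `W_{n+1} E_{n+1}(·, y) = ⟨·, y⟩ E_n(·, y)`. -/
theorem opW_kernelPoly (hR : IsRootSystem R) (hV : IsIntertwiner R β k (intertwiner R β k)) (n : ℕ)
    (y : CSpace d) :
    opW R β k (n + 1) (kernelPoly R β k (n + 1) y) = linForm y * kernelPoly R β k n y := by
  rw [← sum_X_mul_polyDunkl hR (isHomogeneous_kernelPoly hV _ y), linForm, Finset.sum_mul]
  refine Finset.sum_congr rfl fun i _ => ?_
  rw [polyDunkl_kernelPoly hR hV, toC_single, smul_eq_C_mul]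
  have h : pairing (Pi.single i 1) y = y i := by
    rw [pairing, Finset.sum_eq_single i] <;> simp +contextual
  rw [h]
  ring

/-! ### Estimates of the homogeneous components -/

/-- The best constant `b` in `|E_n(x, y)| ≤ b ‖x‖^n ‖y‖^n` is attained on the unit balls. -/
theorem exists_kernelE_bound_attained (hV : IsIntertwiner R β k (intertwiner R β k)) (n : ℕ) :
    ∃ b : ℝ, (∀ x y, ‖kernelE R β k n x y‖ ≤ b * (hnorm x * hnorm y) ^ n) ∧
      ∃ x y, hnorm x ≤ 1 ∧ hnorm y ≤ 1 ∧ ‖kernelE R β k n x y‖ = b := by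
  let B := Metric.closedBall (0 : EuclideanSpace ℂ (Fin d)) 1
  have hc : Continuous fun q : EuclideanSpace ℂ (Fin d) × EuclideanSpace ℂ (Fin d) =>
      ‖kernelE R β k n q.1.ofLp q.2.ofLp‖ :=
    ((differentiable_kernelE n).continuous.comp (f := fun q : EuclideanSpace ℂ (Fin d) ×
      EuclideanSpace ℂ (Fin d) => (q.1.ofLp, q.2.ofLp)) (by fun_prop)).norm
  have hB : IsCompact (B ×ˢ B) := (isCompact_closedBall _ _).prod (isCompact_closedBall _ _)
  obtain ⟨⟨x₀, y₀⟩, hq, hmax⟩ := hB.exists_isMaxOn ⟨(0, 0), by simp [B]⟩ hc.continuousOn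
  have hmem : ∀ x : CSpace d, hnorm x ≤ 1 → (WithLp.toLp 2 x : EuclideanSpace ℂ (Fin d)) ∈ B :=
    fun x hx => by simpa [B, hnorm] using hx
  refine ⟨‖kernelE R β k n x₀.ofLp y₀.ofLp‖, fun x y => ?_, x₀.ofLp, y₀.ofLp, ?_, ?_, rfl⟩
  · have hscale : ∀ x : CSpace d, ∃ u : CSpace d, hnorm u ≤ 1 ∧ x = (hnorm x : ℂ) • u := by
      intro x
      rcases eq_or_ne x 0 with rfl | hx
      · exact ⟨0, by simp [hnorm_eq_zero.2], by simp⟩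
      · have h0 : hnorm x ≠ 0 := fun h => hx (hnorm_eq_zero.1 h)
        refine ⟨((hnorm x)⁻¹ : ℂ) • x, ?_, ?_⟩
        · rw [hnorm_smul, norm_inv, Complex.norm_real, Real.norm_of_nonneg (hnorm_nonneg x),
            inv_mul_cancel₀ h0]
        · rw [smul_smul, mul_inv_cancel₀ (by exact_mod_cast h0), one_smul]
    obtain ⟨u, hu, hxu⟩ := hscale x
    obtain ⟨v, hv, hyv⟩ := hscale y
    have h1 : ‖kernelE R β k n u v‖ ≤ ‖kernelE R β k n x₀.ofLp y₀.ofLp‖ :=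
      isMaxOn_iff.1 hmax (WithLp.toLp 2 u, WithLp.toLp 2 v) ⟨hmem u hu, hmem v hv⟩
    conv_lhs => rw [hxu, hyv]
    rw [kernelE_smul_left hV, kernelE_smul_right, norm_mul, norm_mul, norm_pow, norm_pow,
      Complex.norm_real, Complex.norm_real, Real.norm_of_nonneg (hnorm_nonneg x),
      Real.norm_of_nonneg (hnorm_nonneg y), mul_pow]
    have hx := pow_nonneg (hnorm_nonneg x) n
    have hy := pow_nonneg (hnorm_nonneg y) n
    generalize ‖kernelE R β k n u v‖ = A at h1 ⊢
    generalize ‖kernelE R β k n x₀.ofLp y₀.ofLp‖ = M at h1 ⊢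
    calc hnorm x ^ n * (hnorm y ^ n * A) = A * (hnorm x ^ n * hnorm y ^ n) := by ring
      _ ≤ M * (hnorm x ^ n * hnorm y ^ n) := mul_le_mul_of_nonneg_right h1 (mul_nonneg hx hy)
  · simpa [B, hnorm] using hq.1
  · simpa [B, hnorm] using hq.2

/-- Since `W_n` is a bounded perturbation of `n`, with respect to a norm invariant under the
reflections, inverting it gains a factor of order `1 / n`. The factor `2^n` makes up for the
perturbation. -/
theorem exists_kernelE_bound (hR : IsRootSystem R)
    (hV : IsIntertwiner R β k (intertwiner R β k)) :
    ∃ C : ℝ, 0 ≤ C ∧ ∀ n x y,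
      ‖kernelE R β k n x y‖ ≤ C * ((2 * (hnorm x * hnorm y)) ^ n / n.factorial) := by
  choose b hb hatt using exists_kernelE_bound_attained (R := R) (β := β) (k := k) hV
  have hb0 : ∀ n, 0 ≤ b n := fun n => by
    obtain ⟨x, y, _, _, h⟩ := hatt n
    exact h ▸ norm_nonneg _
  set K := ∑ α ∈ posRoots R β, ‖k α‖ with hK
  have hrec : ∀ n : ℕ, (n + 1 : ℝ) * b (n + 1) ≤ 2 * K * b (n + 1) + b n := by
    intro n
    obtain ⟨x, y, hx, hy, h⟩ := hatt (n + 1)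
    have h1 := congrArg (eval x) (opW_kernelPoly hR hV n y)
    rw [eval_opW, map_mul, eval_linForm] at h1
    simp only [eval_kernelPoly] at h1
    have h2 : ((n + 1 : ℕ) : ℂ) * kernelE R β k (n + 1) x y =
        pairing x y * kernelE R β k n x y - ∑ α ∈ posRoots R β,
          k α * (kernelE R β k (n + 1) x y - kernelE R β k (n + 1) (reflC α x) y) := by
      rw [← h1]
      ring
    have hone : ∀ m : ℕ, (hnorm x * hnorm y) ^ m ≤ 1 := fun m =>
      pow_le_one₀ (mul_nonneg (hnorm_nonneg _) (hnorm_nonneg _))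
        (mul_le_one₀ hx (hnorm_nonneg _) hy)
    have h3 : ‖pairing x y * kernelE R β k n x y‖ ≤ b n := by
      rw [norm_mul]
      have e1 : ‖pairing x y‖ ≤ 1 := by simpa using (norm_pairing_le x y).trans (by simpa using hone 1)
      have e2 : ‖kernelE R β k n x y‖ ≤ b n :=
        (hb n x y).trans (mul_le_of_le_one_right (hb0 n) (hone n))
      calc _ ≤ 1 * b n := mul_le_mul e1 e2 (norm_nonneg _) zero_le_one
        _ = b n := one_mul _
    have h4 : ‖∑ α ∈ posRoots R β,
        k α * (kernelE R β k (n + 1) x y - kernelE R β k (n + 1) (reflC α x) y)‖ ≤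
        2 * K * b (n + 1) := by
      refine (norm_sum_le _ _).trans ?_
      rw [hK, mul_comm 2, mul_assoc, Finset.sum_mul]
      refine Finset.sum_le_sum fun α _ => ?_
      rw [norm_mul]
      refine mul_le_mul_of_nonneg_left ?_ (norm_nonneg _)
      refine (norm_sub_le _ _).trans ?_
      have e3 : ‖kernelE R β k (n + 1) (reflC α x) y‖ ≤ b (n + 1) := by
        refine (hb _ _ _).trans (mul_le_of_le_one_right (hb0 _) ?_)
        rw [hnorm_reflC]
        exact hone _
      rw [h]
      linarith
    have h5 := congrArg norm h2
    rw [norm_mul, Complex.norm_natCast, h] at h5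
    push_cast at h5
    rw [h5]
    linarith [norm_sub_le (pairing x y * kernelE R β k n x y) (∑ α ∈ posRoots R β,
        k α * (kernelE R β k (n + 1) x y - kernelE R β k (n + 1) (reflC α x) y))]
  -- the normalized constants `b_n n! / 2^n` do not increase once `n ≥ 4K`
  set c : ℕ → ℝ := fun n => b n * n.factorial / 2 ^ n with hc
  have hc0 : ∀ n, 0 ≤ c n := fun n => by
    have := hb0 n
    positivity
  obtain ⟨N, hN⟩ := exists_nat_ge (4 * K)
  have hstep : ∀ n, N ≤ n → c (n + 1) ≤ c n := by
    intro n hn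
    -- for `n ≥ 4K` the term `2 K b_{n+1}` of `hrec` takes up at most half of the left-hand side
    have hn' : (N : ℝ) ≤ n := by exact_mod_cast hn
    have h1 : (n + 1 : ℝ) * b (n + 1) ≤ 2 * b n := by
      nlinarith [hrec n, hb0 (n + 1)]
    simp only [hc]
    rw [Nat.factorial_succ, pow_succ, div_le_div_iff₀ (by positivity) (by positivity)]
    push_cast
    have h2 : (0 : ℝ) ≤ n.factorial * 2 ^ n := by positivity
    nlinarith [mul_le_mul_of_nonneg_left h1 h2]
  have hle : ∀ n, N ≤ n → c n ≤ c N := fun n hn =>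
    Nat.le_induction le_rfl (fun m hm ih => (hstep m hm).trans ih) n hn
  refine ⟨∑ j ∈ Finset.range (N + 1), c j, Finset.sum_nonneg fun j _ => hc0 j, fun n x y => ?_⟩
  have hcn : c n ≤ ∑ j ∈ Finset.range (N + 1), c j := by
    have hs : ∀ j ∈ Finset.range (N + 1), c j ≤ ∑ j ∈ Finset.range (N + 1), c j := fun j hj =>
      Finset.single_le_sum (fun i _ => hc0 i) hj
    rcases le_total n N with h | h
    · exact hs n (by simpa [Nat.lt_succ_iff] using h)
    · exact (hle n h).trans (hs N (by simp))
  have hbc : b n = c n * (2 ^ n / n.factorial) := by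
    simp only [hc]
    have : (n.factorial : ℝ) ≠ 0 := by exact_mod_cast n.factorial_ne_zero
    field_simp
  refine (hb n x y).trans ?_
  have hxy := mul_nonneg (hnorm_nonneg x) (hnorm_nonneg y)
  calc b n * (hnorm x * hnorm y) ^ n
      = c n * ((2 * (hnorm x * hnorm y)) ^ n / n.factorial) := by
        rw [hbc, mul_pow 2]
        ring
    _ ≤ _ := mul_le_mul_of_nonneg_right hcn (by positivity)

/-! ### Existence of the Dunkl kernel -/

/-- A series of entire functions that is normally convergent on bounded sets may be differentiated
term by term. -/
theorem hasFDerivAt_tsum_of_locally_bounded {E : Type*} [NormedAddCommGroup E] [NormedSpace ℂ E]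
    {f : ℕ → E → ℂ} (hf : ∀ n, Differentiable ℂ (f n))
    (hb : ∀ r : ℝ, ∃ u : ℕ → ℝ, Summable u ∧ ∀ n x, ‖x‖ ≤ r → ‖f n x‖ ≤ u n) (x : E) :
    Summable (fun n => fderiv ℂ (f n) x) ∧
      HasFDerivAt (fun x => ∑' n, f n x) (∑' n, fderiv ℂ (f n) x) x := by
  obtain ⟨u, hu, hfu⟩ := hb (‖x‖ + 2)
  have hbound : ∀ n, ∀ y ∈ Metric.ball x 1, ‖fderiv ℂ (f n) y‖ ≤ u n := by
    intro n y hy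
    refine norm_fderiv_le_of_norm_le_closedBall (hf n) fun z hz => hfu n z ?_
    rw [Metric.mem_ball, dist_eq_norm] at hy
    rw [Metric.mem_closedBall, dist_eq_norm] at hz
    calc ‖z‖ = ‖(z - y) + (y - x) + x‖ := by congr 1; abel
      _ ≤ ‖z - y‖ + ‖y - x‖ + ‖x‖ := norm_add₃_le
      _ ≤ ‖x‖ + 2 := by linarith
  have hx : x ∈ Metric.ball x 1 := Metric.mem_ball_self one_pos
  have hpre : IsPreconnected (Metric.ball x 1) := by
    let _ : NormedSpace ℝ E := NormedSpace.restrictScalars ℝ ℂ E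
    exact (convex_ball x 1).isPreconnected
  exact ⟨.of_norm_bounded hu fun n => hbound n x hx, hasFDerivAt_tsum_of_isPreconnected hu
    Metric.isOpen_ball hpre (fun n y _ => (hf n y).hasFDerivAt) hbound hx
    (.of_norm_bounded hu fun n => hfu n x (by linarith)) hx⟩

/-- Dunkl operators may be applied term by term to series of entire functions that are normally
convergent on bounded sets. -/
theorem hasSum_dunklOp {f : ℕ → CSpace d → ℂ} (hf : ∀ n, Differentiable ℂ (f n))
    (hb : ∀ r : ℝ, ∃ u : ℕ → ℝ, Summable u ∧ ∀ n x, ‖x‖ ≤ r → ‖f n x‖ ≤ u n) (ξ x : RSpace d) :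
    HasSum (fun n => dunklOp R β k ξ (fun u => f n (toC u)) x)
      (dunklOp R β k ξ (fun u => ∑' n, f n (toC u)) x) := by
  have hder : ∀ x v : RSpace d, HasSum (fun n => fderiv ℝ (fun u : RSpace d => f n (toC u)) x v)
      (fderiv ℝ (fun u : RSpace d => ∑' n, f n (toC u)) x v) := by
    intro x v
    obtain ⟨hs, hd⟩ := hasFDerivAt_tsum_of_locally_bounded hf hb (toC x)
    rw [(hasFDerivAt_comp_toC hd).fderiv]
    simp only [(hasFDerivAt_comp_toC (hf _ (toC x)).hasFDerivAt).fderiv]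
    exact hs.hasSum.mapL (ContinuousLinearMap.apply ℂ ℂ (toC v))
  have hval : ∀ x : RSpace d, HasSum (fun n => f n (toC x)) (∑' n, f n (toC x)) := by
    intro x
    obtain ⟨u, hu, hfu⟩ := hb ‖toC x‖
    exact (Summable.of_norm_bounded hu fun n => hfu n _ le_rfl).hasSum
  refine (hder x ξ).add (hasSum_sum fun α _ => HasSum.mul_left _ ?_)
  simp only [diffQuot]
  split_ifs
  · exact (hder x α).mul_left _
  · exact ((hval x).sub (hval _)).div_const _

theorem exists_summable_kernelE_bound (hR : IsRootSystem R)
    (hV : IsIntertwiner R β k (intertwiner R β k)) (r : ℝ) :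
    ∃ u : ℕ → ℝ, Summable u ∧ ∀ n x y, hnorm x * hnorm y ≤ r → ‖kernelE R β k n x y‖ ≤ u n := by
  obtain ⟨C, hC, hbound⟩ := exists_kernelE_bound hR hV
  refine ⟨fun n => C * ((2 * r) ^ n / n.factorial),
    (Real.summable_pow_div_factorial _).mul_left C, fun n x y h => (hbound n x y).trans ?_⟩
  have h0 := mul_nonneg (hnorm_nonneg x) (hnorm_nonneg y)
  exact mul_le_mul_of_nonneg_left (div_le_div_of_nonneg_right
    (pow_le_pow_left₀ (by linarith) (by linarith) n) (Nat.cast_nonneg _)) hC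

/-- The Dunkl kernel as the sum of its homogeneous components. -/
theorem isDunklKernel_tsum (hR : IsRootSystem R)
    (hV : IsIntertwiner R β k (intertwiner R β k)) :
    IsDunklKernel R β k fun x y => ∑' n, kernelE R β k n x y := by
  have hleft : ∀ n y, Differentiable ℂ fun x => kernelE R β k n x y := fun n y =>
    (differentiable_kernelE n).comp (f := fun x => (x, y)) (by fun_prop)
  refine ⟨fun q => ?_, fun y => ?_, fun y ξ x => ?_⟩
  · refine (hasFDerivAt_tsum_of_locally_bounded (fun n => differentiable_kernelE n)
      (fun r => ?_) q).2.differentiableAt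
    obtain ⟨u, hu, hbound⟩ := exists_summable_kernelE_bound hR hV ((d * r) * (d * r))
    refine ⟨u, hu, fun n q hq => hbound n _ _ ?_⟩
    have h1 : hnorm q.1 ≤ d * r :=
      (hnorm_le _).trans (mul_le_mul_of_nonneg_left ((norm_fst_le q).trans hq) (by positivity))
    have h2 : hnorm q.2 ≤ d * r :=
      (hnorm_le _).trans (mul_le_mul_of_nonneg_left ((norm_snd_le q).trans hq) (by positivity))
    exact mul_le_mul h1 h2 (hnorm_nonneg _) ((hnorm_nonneg _).trans h1)
  · rw [tsum_eq_single 0]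
    · exact kernelE_zero hV _ _
    · intro n hn
      have h := kernelE_smul_left hV n 0 0 (toC y)
      rwa [zero_smul, zero_pow hn, zero_mul] at h
  · have hb : ∀ r : ℝ, ∃ u : ℕ → ℝ, Summable u ∧
        ∀ n (x : CSpace d), ‖x‖ ≤ r → ‖kernelE R β k n x (toC y)‖ ≤ u n := by
      intro r
      obtain ⟨u, hu, hbound⟩ := exists_summable_kernelE_bound hR hV ((d * r) * hnorm (toC y))
      refine ⟨u, hu, fun n x hx => hbound n _ _ ?_⟩
      exact mul_le_mul_of_nonneg_right ((hnorm_le _).trans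
        (mul_le_mul_of_nonneg_left hx (by positivity))) (hnorm_nonneg _)
    have h1 := hasSum_dunklOp (R := R) (β := β) (k := k) (fun n => hleft n (toC y)) hb ξ x
    have hterm : ∀ n, dunklOp R β k ξ (fun u => kernelE R β k n (toC u) (toC y)) x =
        polyFun (polyDunkl R β k ξ (kernelPoly R β k n (toC y))) x := by
      intro n
      rw [← dunklOp_polyFun hR]
      congr 1
      funext u
      exact (eval_kernelPoly n _ _).symm
    have h2 : HasSum (fun n => dunklOp R β k ξ (fun u => kernelE R β k n (toC u) (toC y)) x)
        (((inner ℝ ξ y : ℝ) : ℂ) * ∑' n, kernelE R β k n (toC x) (toC y)) := by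
      rw [← hasSum_nat_add_iff' 1]
      have h0 : dunklOp R β k ξ (fun u => kernelE R β k 0 (toC u) (toC y)) x = 0 := by
        rw [hterm, kernelPoly, pow_zero, hV.map_one, map_smul, ← C_1, polyDunkl_C hR, smul_zero]
        simp [polyFun]
      rw [Finset.sum_range_one, h0, sub_zero]
      simp only [hterm, polyDunkl_kernelPoly hR hV, polyFun_smul, pairing_toC]
      refine HasSum.mul_left ((inner ℝ ξ y : ℝ) : ℂ) ?_
      obtain ⟨u, hu, hbound⟩ := hb ‖toC x‖
      simp only [polyFun, eval_kernelPoly]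
      exact (Summable.of_norm_bounded hu fun n => hbound n _ le_rfl).hasSum
    exact h1.unique h2

theorem isDunklKernel_dunklKernel (hR : IsRootSystem R)
    (hV : IsIntertwiner R β k (intertwiner R β k)) :
    IsDunklKernel R β k (dunklKernel R β k) :=
  Classical.epsilon_spec ⟨_, isDunklKernel_tsum hR hV⟩

theorem hasSum_kernelE (hR : IsRootSystem R) (hkM : InMStar R β k)
    (hV : IsIntertwiner R β k (intertwiner R β k)) (x y : CSpace d) :
    HasSum (fun n => kernelE R β k n x y) (dunklKernel R β k x y) := by
  have h := congrFun (congrFun (IsDunklKernel.unique hkM (isDunklKernel_dunklKernel hR hV)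
    (isDunklKernel_tsum hR hV)) x) y
  rw [h]
  obtain ⟨u, hu, hbound⟩ := exists_summable_kernelE_bound hR hV (hnorm x * hnorm y)
  exact (Summable.of_norm_bounded hu fun n => hbound n _ _ le_rfl).hasSum

/-! ### The operator `e^{-Δ/2}` on polynomials -/

/-- The Laplacian on polynomials. -/
def polyLaplacian : Poly d →ₗ[ℂ] Poly d :=
  ∑ i, (pderiv i : Derivation ℂ (Poly d) (Poly d)).toLinearMap ∘ₗ (pderiv i).toLinearMap

theorem polyLaplacian_apply (p : Poly d) : polyLaplacian p = ∑ i, pderiv i (pderiv i p) := by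
  simp [polyLaplacian]

theorem pderiv_comm (i j : Fin d) (p : Poly d) : pderiv i (pderiv j p) = pderiv j (pderiv i p) := by
  induction p using MvPolynomial.induction_on with
  | C a => simp
  | add p q hp hq => simp only [map_add, hp, hq]
  | mul_X p l hp =>
    have h : ∀ i j : Fin d, pderiv i (pderiv j (X l : Poly d)) = 0 := fun i j => by
      rw [pderiv_X, Pi.single_apply]
      split_ifs <;> simp
    simp only [pderiv_mul, map_add, hp, h]
    ring

theorem pderiv_polyLaplacian (i : Fin d) (p : Poly d) :
    pderiv i (polyLaplacian p) = polyLaplacian (pderiv i p) := by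
  simp only [polyLaplacian_apply, map_sum]
  exact Finset.sum_congr rfl fun j _ => by rw [pderiv_comm i j, pderiv_comm i j]

theorem polyLaplacian_X_mul (i : Fin d) (p : Poly d) :
    polyLaplacian (X i * p) = X i * polyLaplacian p + (2 : ℂ) • pderiv i p := by
  simp only [polyLaplacian_apply]
  have h : ∀ j : Fin d, pderiv j (pderiv j (X i * p)) = X i * pderiv j (pderiv j p) +
      (if j = i then (2 : ℂ) • pderiv i p else 0) := by
    intro j
    by_cases hj : j = i
    · subst hj
      simp only [pderiv_mul, pderiv_X_self, map_add, one_mul, if_true, two_smul]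
      ring
    · simp [pderiv_X_of_ne (Ne.symm hj), hj]
  simp only [h, Finset.sum_add_distrib, Finset.mul_sum, Finset.sum_ite_eq', Finset.mem_univ,
    if_true]

theorem pderiv_polyLaplacian_pow (i : Fin d) (m : ℕ) (p : Poly d) :
    pderiv i ((polyLaplacian ^ m) p) = (polyLaplacian ^ m) (pderiv i p) := by
  induction m generalizing p with
  | zero => simp
  | succ m ih => rw [pow_succ, Module.End.mul_apply, ih, pderiv_polyLaplacian, Module.End.mul_apply]

theorem polyLaplacian_pow_succ_X_mul (i : Fin d) (m : ℕ) (p : Poly d) :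
    (polyLaplacian ^ (m + 1)) (X i * p) = X i * (polyLaplacian ^ (m + 1)) p +
      (2 * (m + 1) : ℂ) • pderiv i ((polyLaplacian ^ m) p) := by
  induction m with
  | zero => simp [polyLaplacian_X_mul]
  | succ m ih =>
    rw [pow_succ' _ (m + 1), Module.End.mul_apply, ih, map_add, polyLaplacian_X_mul, map_smul,
      ← pderiv_polyLaplacian, ← Module.End.mul_apply, ← Module.End.mul_apply, ← pow_succ',
      ← pow_succ']
    push_cast
    module

/-- The Laplacian is locally nilpotent on polynomials. -/
theorem exists_polyLaplacian_pow_eq_zero (p : Poly d) :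
    ∃ N, ∀ m, N ≤ m → (polyLaplacian ^ m) p = 0 := by
  induction p using MvPolynomial.induction_on with
  | C a =>
    refine ⟨1, fun m hm => ?_⟩
    obtain ⟨m, rfl⟩ := Nat.exists_eq_add_of_le' hm
    rw [pow_succ, Module.End.mul_apply, polyLaplacian_apply]
    simp
  | add p q hp hq =>
    obtain ⟨N, hN⟩ := hp
    obtain ⟨M, hM⟩ := hq
    exact ⟨max N M, fun m hm => by
      rw [map_add, hN m (le_of_max_le_left hm), hM m (le_of_max_le_right hm), add_zero]⟩
  | mul_X p i hp =>
    obtain ⟨N, hN⟩ := hp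
    refine ⟨N + 1, fun m hm => ?_⟩
    obtain ⟨m, rfl⟩ := Nat.exists_eq_add_of_le' (Nat.one_le_of_lt hm)
    rw [mul_comm, polyLaplacian_pow_succ_X_mul, hN _ (by omega), hN _ (by omega)]
    simp

/-- The coefficients of the series of `e^{-t/2}`. -/
def heatCoeff (m : ℕ) : ℂ := (-1 / 2 : ℂ) ^ m / (m.factorial : ℂ)

theorem heatCoeff_succ (m : ℕ) : heatCoeff (m + 1) * (2 * (m + 1)) = -heatCoeff m := by
  have h1 : ((m : ℂ) + 1) ≠ 0 := Nat.cast_add_one_ne_zero m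
  have h2 : (m.factorial : ℂ) ≠ 0 := by exact_mod_cast m.factorial_ne_zero
  rw [heatCoeff, heatCoeff, Nat.factorial_succ]
  push_cast
  field_simp
  ring

theorem hasFiniteSupport_heatCoeff_smul (p : Poly d) :
    (Function.support fun m => heatCoeff m • (polyLaplacian ^ m) p).Finite := by
  obtain ⟨N, hN⟩ := exists_polyLaplacian_pow_eq_zero p
  refine (Set.finite_lt_nat N).subset fun m hm => ?_
  by_contra h
  exact hm (by simp [hN m (not_lt.1 h)])

/-- The operator `e^{-Δ/2} = ∑_m (-1/2)^m / m! Δ^m` on polynomials. -/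
def expNegHalfPolyLaplacian : Poly d →ₗ[ℂ] Poly d where
  toFun p := ∑ᶠ m, heatCoeff m • (polyLaplacian ^ m) p
  map_add' p q := by
    simp only [map_add, smul_add]
    exact finsum_add_distrib (hasFiniteSupport_heatCoeff_smul p) (hasFiniteSupport_heatCoeff_smul q)
  map_smul' c p := by
    simp only [map_smul, RingHom.id_apply]
    rw [smul_finsum]
    simp only [smul_comm c]

theorem expNegHalfPolyLaplacian_eq_sum {p : Poly d} {N : ℕ}
    (hN : ∀ m, N ≤ m → (polyLaplacian ^ m) p = 0) :
    expNegHalfPolyLaplacian p = ∑ m ∈ Finset.range N, heatCoeff m • (polyLaplacian ^ m) p := by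
  refine finsum_eq_sum_of_support_subset _ fun m hm => ?_
  rw [Finset.coe_range, Set.mem_Iio]
  by_contra h
  exact hm (by simp [hN m (not_lt.1 h)])

theorem expNegHalfPolyLaplacian_one : expNegHalfPolyLaplacian (1 : Poly d) = 1 := by
  rw [expNegHalfPolyLaplacian_eq_sum (N := 1)]
  · simp [heatCoeff]
  · intro m hm
    obtain ⟨m, rfl⟩ := Nat.exists_eq_add_of_le' hm
    rw [pow_succ, Module.End.mul_apply, polyLaplacian_apply]
    simp

/-- `e^{-Δ/2} x_i = (x_i - ∂_i) e^{-Δ/2}`. -/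
theorem expNegHalfPolyLaplacian_X_mul (i : Fin d) (p : Poly d) :
    expNegHalfPolyLaplacian (X i * p) =
      X i * expNegHalfPolyLaplacian p - pderiv i (expNegHalfPolyLaplacian p) := by
  obtain ⟨N, hN⟩ := exists_polyLaplacian_pow_eq_zero p
  obtain ⟨M, hM⟩ := exists_polyLaplacian_pow_eq_zero (X i * p)
  rw [expNegHalfPolyLaplacian_eq_sum (N := max N M + 1) fun m hm => hM m (by omega),
    Finset.sum_range_succ']
  have h : ∀ m, heatCoeff (m + 1) • (polyLaplacian ^ (m + 1)) (X i * p) =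
      X i * (heatCoeff (m + 1) • (polyLaplacian ^ (m + 1)) p) -
        pderiv i (heatCoeff m • (polyLaplacian ^ m) p) := by
    intro m
    rw [polyLaplacian_pow_succ_X_mul, smul_add, smul_smul, heatCoeff_succ, Derivation.map_smul,
      mul_smul_comm, neg_smul, sub_eq_add_neg]
  simp only [h, Finset.sum_sub_distrib]
  rw [← map_sum, ← Finset.mul_sum,
    ← expNegHalfPolyLaplacian_eq_sum (N := max N M) fun m hm => hN m (by omega),
    expNegHalfPolyLaplacian_eq_sum (p := p) (N := max N M + 1) fun m hm => hN m (by omega),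
    Finset.sum_range_succ']
  simp only [pow_zero, Module.End.one_apply, mul_add, mul_smul_comm]
  abel

/-- `e^{-Δ/2}` commutes with the partial derivatives. -/
theorem pderiv_expNegHalfPolyLaplacian (i : Fin d) (p : Poly d) :
    pderiv i (expNegHalfPolyLaplacian p) = expNegHalfPolyLaplacian (pderiv i p) := by
  obtain ⟨N, hN⟩ := exists_polyLaplacian_pow_eq_zero p
  rw [expNegHalfPolyLaplacian_eq_sum hN, expNegHalfPolyLaplacian_eq_sum (N := N)
    fun m hm => by rw [← pderiv_polyLaplacian_pow, hN m hm, map_zero], map_sum]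
  simp only [Derivation.map_smul, pderiv_polyLaplacian_pow]

/-! ### Comparison with the Laplacian of functions -/

theorem contDiff_polyFun (p : Poly d) {n : WithTop ℕ∞} : ContDiff ℝ n (polyFun p) := by
  have h : polyFun p = (fun x : CSpace d => eval x p) ∘ toCL := rfl
  rw [h]
  refine ContDiff.comp ?_ (toCL (d := d)).contDiff
  induction p using MvPolynomial.induction_on with
  | C a => simpa using contDiff_const
  | add p q hp hq =>
    simp only [map_add]
    exact (hp rfl).add (hq rfl)
  | mul_X p i hp =>
    simp only [map_mul, eval_X]
    exact (hp rfl).mul (contDiff_apply ℝ ℂ i)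

theorem laplacian_polyFun (p : Poly d) :
    Laplacian.laplacian (polyFun p) = polyFun (polyLaplacian p) := by
  rw [InnerProductSpace.laplacian_eq_iteratedFDeriv_orthonormalBasis _
    (EuclideanSpace.basisFun (Fin d) ℝ)]
  funext x
  rw [polyLaplacian_apply, polyFun_sum]
  refine Finset.sum_congr rfl fun i _ => ?_
  rw [iteratedFDeriv_two_apply]
  simp only [EuclideanSpace.basisFun_apply, Matrix.cons_val_zero, Matrix.cons_val_one]
  have h1 : DifferentiableAt ℝ (fderiv ℝ (polyFun p)) x :=
    ((ContDiff.fderiv_right (m := 1) (n := 2) (contDiff_polyFun p)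
      (by norm_num)).differentiable one_ne_zero) x
  have h2 : fderiv ℝ (fun u => fderiv ℝ (polyFun p) u (EuclideanSpace.single i 1)) x
      (EuclideanSpace.single i 1) = fderiv ℝ (fderiv ℝ (polyFun p)) x
        (EuclideanSpace.single i 1) (EuclideanSpace.single i 1) := by
    rw [fderiv_clm_apply h1 (differentiableAt_const _)]
    simp
  rw [← h2]
  simp only [fderiv_polyFun, polyDeriv_single]

theorem expNegHalfLaplacian_polyFun (p : Poly d) (z : RSpace d) :
    expNegHalfLaplacian (polyFun p) z = polyFun (expNegHalfPolyLaplacian p) z := by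
  have h : ∀ m, (Laplacian.laplacian^[m] (polyFun p)) = polyFun ((polyLaplacian ^ m) p) := by
    intro m
    induction m with
    | zero => simp
    | succ m ih =>
      rw [Function.iterate_succ_apply', ih, laplacian_polyFun, pow_succ', Module.End.mul_apply]
  obtain ⟨N, hN⟩ := exists_polyLaplacian_pow_eq_zero p
  rw [expNegHalfLaplacian, expNegHalfPolyLaplacian_eq_sum hN, polyFun_sum]
  simp only [h, polyFun_smul]
  refine tsum_eq_sum fun m hm => ?_
  rw [hN m (by simpa using hm)]
  simp [polyFun]

/-! ### Functionals of Gaussian type -/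

/-- A linear functional `L` on polynomials with `L(x_i p) = w_i L(p) + s L(∂_i p)` is determined by
its value at `1`. -/
theorem linearMap_eq_of_X_mul {L M : Poly d →ₗ[ℂ] ℂ} (w : CSpace d) (s : ℂ)
    (hL : ∀ i p, L (X i * p) = w i * L p + s * L (pderiv i p))
    (hM : ∀ i p, M (X i * p) = w i * M p + s * M (pderiv i p)) (h1 : L 1 = M 1) (p : Poly d) :
    L p = M p := by
  have hhom : ∀ n, ∀ p : Poly d, p.IsHomogeneous n → L p = M p := by
    intro n
    induction n using Nat.strong_induction_on with
    | _ n ih =>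
      intro p hp
      cases n with
      | zero =>
        rw [eq_C_of_isHomogeneous_zero hp, ← mul_one (C _), ← smul_eq_C_mul, map_smul, map_smul, h1]
      | succ n =>
        have hE := hp.sum_X_mul_pderiv
        have h2 : ∑ i, L (X i * pderiv i p) = ∑ i, M (X i * pderiv i p) := by
          refine Finset.sum_congr rfl fun i _ => ?_
          have hd : (pderiv i p).IsHomogeneous n := hp.pderiv
          have hdd : (pderiv i (pderiv i p)).IsHomogeneous (n - 1) := hd.pderiv
          rw [hL, hM, ih n (by omega) _ hd, ih (n - 1) (by omega) _ hdd]
        rw [← map_sum, ← map_sum, hE, map_nsmul, map_nsmul] at h2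
        exact nsmul_right_injective n.succ_ne_zero h2
  rw [← sum_homogeneousComponent p, map_sum, map_sum]
  exact Finset.sum_congr rfl fun n _ => hhom n _ (homogeneousComponent_isHomogeneous n p)

/-! ### Gaussian integrals of functions of exponential growth -/

/-- The function `h` on `ℝ^d` is continuous and of at most exponential growth. -/
def HasExpGrowth (h : RSpace d → ℂ) : Prop :=
  Continuous h ∧ ∃ C A : ℝ, 0 ≤ C ∧ 0 ≤ A ∧ ∀ u, ‖h u‖ ≤ C * Real.exp (A * ‖u‖)

theorem HasExpGrowth.const (c : ℂ) : HasExpGrowth fun _ : RSpace d => c :=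
  ⟨continuous_const, ‖c‖, 0, norm_nonneg _, le_rfl, fun u => by simp⟩

theorem HasExpGrowth.add {f g : RSpace d → ℂ} (hf : HasExpGrowth f) (hg : HasExpGrowth g) :
    HasExpGrowth fun u => f u + g u := by
  obtain ⟨hfc, C, A, hC, hA, hf⟩ := hf
  obtain ⟨hgc, D, B, hD, hB, hg⟩ := hg
  refine ⟨hfc.add hgc, C + D, A + B, by positivity, by positivity, fun u => ?_⟩
  have h1 : Real.exp (A * ‖u‖) ≤ Real.exp ((A + B) * ‖u‖) :=
    Real.exp_le_exp.2 (mul_le_mul_of_nonneg_right (by linarith) (norm_nonneg u))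
  have h2 : Real.exp (B * ‖u‖) ≤ Real.exp ((A + B) * ‖u‖) :=
    Real.exp_le_exp.2 (mul_le_mul_of_nonneg_right (by linarith) (norm_nonneg u))
  calc ‖f u + g u‖ ≤ C * Real.exp (A * ‖u‖) + D * Real.exp (B * ‖u‖) :=
        (norm_add_le _ _).trans (add_le_add (hf u) (hg u))
    _ ≤ (C + D) * Real.exp ((A + B) * ‖u‖) := by
        rw [add_mul]
        exact add_le_add (mul_le_mul_of_nonneg_left h1 hC) (mul_le_mul_of_nonneg_left h2 hD)

theorem HasExpGrowth.mul {f g : RSpace d → ℂ} (hf : HasExpGrowth f) (hg : HasExpGrowth g) :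
    HasExpGrowth fun u => f u * g u := by
  obtain ⟨hfc, C, A, hC, hA, hf⟩ := hf
  obtain ⟨hgc, D, B, hD, hB, hg⟩ := hg
  refine ⟨hfc.mul hgc, C * D, A + B, by positivity, by positivity, fun u => ?_⟩
  rw [norm_mul, add_mul, Real.exp_add]
  calc ‖f u‖ * ‖g u‖ ≤ (C * Real.exp (A * ‖u‖)) * (D * Real.exp (B * ‖u‖)) :=
        mul_le_mul (hf u) (hg u) (norm_nonneg _) (by positivity)
    _ = _ := by ring

theorem HasExpGrowth.apply (i : Fin d) : HasExpGrowth fun u : RSpace d => toC u i := by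
  refine ⟨by unfold toC; fun_prop, 1, 1, zero_le_one, zero_le_one, fun u => ?_⟩
  have h := norm_apply_le_hnorm (toC u) i
  rw [hnorm_toC] at h
  linarith [Real.add_one_le_exp (1 * ‖u‖)]

theorem HasExpGrowth.eval (a : CSpace d) (c : ℂ) (p : Poly d) :
    HasExpGrowth fun u => eval (a + c • toC u) p := by
  induction p using MvPolynomial.induction_on with
  | C b => simpa using HasExpGrowth.const b
  | add p q hp hq => simpa using hp.add hq
  | mul_X p i hp =>
    have h := hp.mul ((HasExpGrowth.const (a i)).add
      ((HasExpGrowth.const c).mul (HasExpGrowth.apply i)))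
    simpa using h

/-- By completing the square, `A t - t²/2 ≤ A² - t²/4`. -/
theorem integrable_exp_mul_norm (A : ℝ) :
    Integrable fun u : RSpace d => Real.exp (A * ‖u‖) * Real.exp (-‖u‖ ^ 2 / 2) := by
  have h1 : Integrable fun u : RSpace d => Real.exp (A ^ 2) * Real.exp (-‖u‖ ^ 2 / 4) := by
    refine Integrable.const_mul ?_ _
    have h := (GaussianFourier.integrable_cexp_neg_mul_sq_norm_add (V := RSpace d) (b := 1 / 4)
      (by norm_num) 0 0).norm
    refine h.congr (Filter.Eventually.of_forall fun u => ?_)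
    simp only [zero_mul, add_zero, Complex.norm_exp]
    congr 1
    have : (-(1 / 4 : ℂ) * (‖u‖ : ℂ) ^ 2) = ((-‖u‖ ^ 2 / 4 : ℝ) : ℂ) := by
      push_cast
      ring
    rw [this, Complex.ofReal_re]
  refine h1.mono' (by fun_prop) (Filter.Eventually.of_forall fun u => ?_)
  rw [Real.norm_of_nonneg (by positivity), ← Real.exp_add, ← Real.exp_add]
  refine Real.exp_le_exp.2 ?_
  nlinarith [sq_nonneg (A - ‖u‖ / 2)]

theorem continuous_gauss (b : CSpace d) : Continuous fun u : RSpace d => gauss (b - toC u) := by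
  unfold gauss pairing toC
  simp only [Pi.sub_apply]
  fun_prop

theorem pairing_sub_sub (b u : CSpace d) :
    pairing (b - u) (b - u) = pairing u u - 2 * pairing b u + pairing b b := by
  simp only [pairing, Pi.sub_apply, Finset.mul_sum, ← Finset.sum_sub_distrib,
    ← Finset.sum_add_distrib]
  exact Finset.sum_congr rfl fun i _ => by ring

theorem norm_gauss_le (b : CSpace d) (u : RSpace d) : ‖gauss (b - toC u)‖ ≤
    Real.exp (hnorm b ^ 2 / 2) * (Real.exp (hnorm b * ‖u‖) * Real.exp (-‖u‖ ^ 2 / 2)) := by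
  rw [gauss, Complex.norm_exp, ← Real.exp_add, ← Real.exp_add]
  refine Real.exp_le_exp.2 ?_
  have h1 : (-pairing (b - toC u) (b - toC u) / 2).re =
      -‖u‖ ^ 2 / 2 + (pairing b (toC u)).re - (pairing b b).re / 2 := by
    rw [pairing_sub_sub, pairing_toC, real_inner_self_eq_norm_sq]
    simp
    rw [← Complex.ofReal_pow, Complex.ofReal_re]
    ring
  have h2 : (pairing b (toC u)).re ≤ hnorm b * ‖u‖ := by
    rw [← hnorm_toC]
    exact (Complex.re_le_norm _).trans (norm_pairing_le _ _)
  have h3 : -(pairing b b).re ≤ hnorm b ^ 2 := by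
    rw [sq]
    exact (neg_le_abs _).trans ((Complex.abs_re_le_norm _).trans (norm_pairing_le _ _))
  rw [h1]
  linarith

theorem HasExpGrowth.integrable_mul_gauss {h : RSpace d → ℂ} (hh : HasExpGrowth h)
    (b : CSpace d) : Integrable fun u => h u * gauss (b - toC u) := by
  obtain ⟨hc, C, A, hC, hA, hb⟩ := hh
  refine ((integrable_exp_mul_norm (d := d) (A + hnorm b)).const_mul
    (C * Real.exp (hnorm b ^ 2 / 2))).mono' (hc.mul (continuous_gauss b)).aestronglyMeasurable
      (Filter.Eventually.of_forall fun u => ?_)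
  rw [norm_mul, add_mul, Real.exp_add]
  calc ‖h u‖ * ‖gauss (b - toC u)‖ ≤ (C * Real.exp (A * ‖u‖)) * (Real.exp (hnorm b ^ 2 / 2) *
        (Real.exp (hnorm b * ‖u‖) * Real.exp (-‖u‖ ^ 2 / 2))) :=
        mul_le_mul (hb u) (norm_gauss_le b u) (norm_nonneg _) (by positivity)
    _ = _ := by ring

theorem hasFDerivAt_gauss (w : CSpace d) :
    HasFDerivAt gauss (gauss w • ∑ i, (-w i) • (ContinuousLinearMap.proj i : CSpace d →L[ℂ] ℂ))
      w := by
  have hi : ∀ i : Fin d, HasFDerivAt (fun w : CSpace d => w i)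
      (ContinuousLinearMap.proj i : CSpace d →L[ℂ] ℂ) w := fun i => hasFDerivAt_apply i w
  have h1 : HasFDerivAt (fun w : CSpace d => pairing w w) (∑ i, (w i • (ContinuousLinearMap.proj i :
      CSpace d →L[ℂ] ℂ) + w i • ContinuousLinearMap.proj i)) w :=
    HasFDerivAt.fun_sum fun i _ => (hi i).mul (hi i)
  have h2 := (h1.const_mul (-1 / 2 : ℂ)).cexp
  have h3 : (fun w : CSpace d => Complex.exp (-1 / 2 * pairing w w)) = gauss := by
    funext w
    rw [gauss]
    congr 1
    ring
  rw [h3] at h2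
  refine h2.congr_fderiv ?_
  rw [← h3]
  congr 1
  rw [Finset.smul_sum]
  refine Finset.sum_congr rfl fun i _ => ?_
  module

theorem hasFDerivAt_gauss_sub (b : CSpace d) (u : RSpace d) :
    HasFDerivAt (fun u : RSpace d => gauss (b - toC u))
      ((-(gauss (b - toC u) • ∑ i, (-(b - toC u) i) •
        (ContinuousLinearMap.proj i : CSpace d →L[ℂ] ℂ))).restrictScalars ℝ ∘L toCL) u := by
  have h : HasFDerivAt (fun w : CSpace d => b - w) (-ContinuousLinearMap.id ℂ (CSpace d)) (toC u) :=
    (hasFDerivAt_id _).const_sub b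
  have h2 := (hasFDerivAt_gauss (b - toC u)).comp (toC u) h
  refine hasFDerivAt_comp_toC (F := fun w => gauss (b - w)) (h2.congr_fderiv ?_)
  ext v
  simp

theorem hasFDerivAt_eval_affine (a : CSpace d) (c : ℂ) (p : Poly d) (u : RSpace d) :
    HasFDerivAt (fun u : RSpace d => eval (a + c • toC u) p)
      ((c • ∑ i, eval (a + c • toC u) (pderiv i p) •
        (ContinuousLinearMap.proj i : CSpace d →L[ℂ] ℂ)).restrictScalars ℝ ∘L toCL) u := by
  have h : HasFDerivAt (fun w : CSpace d => a + c • w) (c • ContinuousLinearMap.id ℂ (CSpace d))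
    (toC u) := ((hasFDerivAt_id _).const_smul c).const_add a
  have h2 := (hasFDerivAt_eval p (a + c • toC u)).comp (toC u) h
  refine hasFDerivAt_comp_toC (F := fun w => eval (a + c • w) p) (h2.congr_fderiv ?_)
  ext v
  simp

/-- The functional `q ↦ ∫ q(a + c u) e^{-‖b - u‖²/2} du`, where `a, b ∈ ℂ^d` and `c ∈ ℂ`. -/
def gaussFunctional (a b : CSpace d) (c : ℂ) : Poly d →ₗ[ℂ] ℂ where
  toFun q := ∫ u : RSpace d, eval (a + c • toC u) q * gauss (b - toC u)
  map_add' p q := by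
    simp only [map_add, add_mul]
    exact integral_add ((HasExpGrowth.eval a c p).integrable_mul_gauss b)
      ((HasExpGrowth.eval a c q).integrable_mul_gauss b)
  map_smul' r p := by
    simp only [smul_eval, mul_assoc, RingHom.id_apply, smul_eq_mul]
    exact integral_const_mul _ _

theorem gaussFunctional_apply (a b : CSpace d) (c : ℂ) (q : Poly d) :
    gaussFunctional a b c q = ∫ u : RSpace d, eval (a + c • toC u) q * gauss (b - toC u) := rfl

/-- Integration by parts against the Gaussian; the recursion determines the functional, with
`w = a + c b` and `s = c²` in `linearMap_eq_of_X_mul`. -/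
theorem gaussFunctional_X_mul (a b : CSpace d) (c : ℂ) (i : Fin d) (q : Poly d) :
    gaussFunctional a b c (X i * q) = (a i + c * b i) * gaussFunctional a b c q +
      c ^ 2 * gaussFunctional a b c (pderiv i q) := by
  set v : RSpace d := EuclideanSpace.single i 1 with hv
  have hproj : ∀ L : Fin d → ℂ, (∑ j, L j • (ContinuousLinearMap.proj j : CSpace d →L[ℂ] ℂ))
      (Pi.single i 1) = L i := by
    intro L
    rw [_root_.sum_apply, Finset.sum_eq_single i] <;> simp +contextual
  have hf : ∀ u, fderiv ℝ (fun u : RSpace d => eval (a + c • toC u) q) u v =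
      c * eval (a + c • toC u) (pderiv i q) := by
    intro u
    rw [(hasFDerivAt_eval_affine a c q u).fderiv, ContinuousLinearMap.comp_apply, toCL_apply, hv,
      toC_single, ContinuousLinearMap.coe_restrictScalars', _root_.smul_apply, hproj, smul_eq_mul]
  have hg : ∀ u, fderiv ℝ (fun u : RSpace d => gauss (b - toC u)) u v =
      (b i - toC u i) * gauss (b - toC u) := by
    intro u
    rw [(hasFDerivAt_gauss_sub b u).fderiv, ContinuousLinearMap.comp_apply, toCL_apply, hv,
      toC_single, ContinuousLinearMap.coe_restrictScalars', _root_.neg_apply, _root_.smul_apply,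
      hproj, smul_eq_mul, Pi.sub_apply]
    ring
  have hq := HasExpGrowth.eval a c q
  have hlin : HasExpGrowth fun u : RSpace d => b i + -1 * toC u i :=
    (HasExpGrowth.const _).add ((HasExpGrowth.const _).mul (HasExpGrowth.apply i))
  have hint : Integrable fun u : RSpace d =>
      eval (a + c • toC u) q * ((b i - toC u i) * gauss (b - toC u)) := by
    refine ((hq.mul hlin).integrable_mul_gauss b).congr (Filter.Eventually.of_forall fun u => ?_)
    simp only
    ring
  have hparts := integral_mul_fderiv_eq_neg_fderiv_mul_of_integrable (μ := volume)
    (f := fun u : RSpace d => eval (a + c • toC u) q) (g := fun u => gauss (b - toC u)) (v := v)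
    (by
      simp only [hf, mul_assoc]
      exact ((HasExpGrowth.eval a c (pderiv i q)).integrable_mul_gauss b).const_mul c)
    (by simpa only [hg] using hint) (hq.integrable_mul_gauss b)
    (fun u _ => (hasFDerivAt_eval_affine a c q u).differentiableAt)
    (fun u _ => (hasFDerivAt_gauss_sub b u).differentiableAt)
  simp only [hf, hg, mul_assoc] at hparts
  rw [integral_const_mul] at hparts
  have hsplit : gaussFunctional a b c (X i * q) = (a i + c * b i) * gaussFunctional a b c q -
      c * ∫ u : RSpace d, eval (a + c • toC u) q * ((b i - toC u i) * gauss (b - toC u)) := by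
    simp only [gaussFunctional_apply]
    rw [← integral_const_mul, ← integral_const_mul, ← integral_sub
      ((hq.integrable_mul_gauss b).const_mul _) (hint.const_mul c)]
    refine integral_congr_ae (Filter.Eventually.of_forall fun u => ?_)
    simp only [map_mul, eval_X, Pi.add_apply, Pi.smul_apply, smul_eq_mul]
    ring
  rw [hsplit, hparts, gaussFunctional_apply a b c (pderiv i q)]
  ring

theorem integral_gauss (b : CSpace d) :
    ∫ u : RSpace d, gauss (b - toC u) = ((c0 d : ℝ) : ℂ) := by
  rw [← (PiLp.volume_preserving_toLp (Fin d)).integral_comp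
    (MeasurableEquiv.toLp 2 _).measurableEmbedding]
  have h : ∀ v : Fin d → ℝ, gauss (b - toC (WithLp.toLp 2 v : RSpace d)) =
      Complex.exp (-(∑ i, b i ^ 2) / 2) *
        Complex.exp (-(1 / 2 : ℂ) * ∑ i, (v i : ℂ) ^ 2 + ∑ i, b i * v i) := by
    intro v
    rw [gauss, ← Complex.exp_add, pairing_sub_sub]
    congr 1
    simp only [pairing, toC, ← sq]
    ring
  simp only [h]
  rw [integral_const_mul, GaussianFourier.integral_cexp_neg_mul_sum_add (by norm_num)]
  rw [mul_left_comm, ← Complex.exp_add]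
  have h2 : -(∑ i, b i ^ 2) / 2 + (∑ i, b i ^ 2) / (4 * (1 / 2 : ℂ)) = 0 := by ring
  rw [h2, Complex.exp_zero, mul_one, c0, Complex.ofReal_cpow (by positivity), Fintype.card_fin]
  push_cast
  congr 1
  ring

theorem gaussFunctional_one (a b : CSpace d) (c : ℂ) :
    gaussFunctional a b c 1 = ((c0 d : ℝ) : ℂ) := by
  simp [gaussFunctional_apply, integral_gauss]

/-- The Gauss transform of `e^{-Δ/2} q` is `q`, also at complex points `y`. -/
theorem integral_expNegHalfPolyLaplacian (q : Poly d) (y : CSpace d) :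
    ∫ z : RSpace d, polyFun (expNegHalfPolyLaplacian q) z * gauss (y - toC z) =
      ((c0 d : ℝ) : ℂ) * eval y q := by
  have h := linearMap_eq_of_X_mul (L := gaussFunctional 0 y 1 ∘ₗ expNegHalfPolyLaplacian)
    (M := ((c0 d : ℝ) : ℂ) • (MvPolynomial.aeval y : Poly d →ₐ[ℂ] ℂ).toLinearMap) y 0 ?_ ?_ ?_ q
  · simpa [gaussFunctional_apply, polyFun, MvPolynomial.aeval_eq_eval] using h
  · intro i p
    simp only [LinearMap.comp_apply, expNegHalfPolyLaplacian_X_mul, map_sub, gaussFunctional_X_mul]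
    simp
  · intro i p
    simp
    ring
  · simp [expNegHalfPolyLaplacian_one, gaussFunctional_one]

/-- `e^{-Δ/2} q (z)` is the Gaussian mean of `q` along the imaginary directions at `z`. -/
theorem integral_eval_add_I_smul (q : Poly d) (z : RSpace d) :
    ∫ u : RSpace d, eval (toC z + Complex.I • toC u) q * gauss (0 - toC u) =
      ((c0 d : ℝ) : ℂ) * polyFun (expNegHalfPolyLaplacian q) z := by
  have h := linearMap_eq_of_X_mul (L := gaussFunctional (toC z) 0 Complex.I)
    (M := ((c0 d : ℝ) : ℂ) • (MvPolynomial.aeval (toC z) : Poly d →ₐ[ℂ] ℂ).toLinearMap ∘ₗ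
      expNegHalfPolyLaplacian) (toC z) (-1) ?_ ?_ ?_ q
  · simpa [gaussFunctional_apply, polyFun, MvPolynomial.aeval_eq_eval] using h
  · intro i p
    rw [gaussFunctional_X_mul]
    simp
  · intro i p
    simp only [LinearMap.smul_apply, LinearMap.comp_apply, expNegHalfPolyLaplacian_X_mul, map_sub,
      pderiv_expNegHalfPolyLaplacian, AlgHom.toLinearMap_apply, map_mul, MvPolynomial.aeval_X,
      smul_eq_mul]
    ring
  · simp [expNegHalfPolyLaplacian_one, gaussFunctional_one]

/-! ### The kernel `L_k` and the integral representation -/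

theorem kernelLTerm_eq (x : CSpace d) (z : RSpace d) (n : ℕ) : kernelLTerm R β k x z n =
    polyFun (expNegHalfPolyLaplacian (kernelPolyRight R β k n x)) z := by
  rw [← expNegHalfLaplacian_polyFun, kernelLTerm]
  congr 1
  funext u
  exact (eval_kernelPolyRight n x (toC u)).symm

theorem c0_pos (d : ℕ) : 0 < c0 d := Real.rpow_pos_of_pos (by positivity) _

/-- The terms of the series of `L_k(x, z)` decrease geometrically, with a constant of exponential
growth in `z`. They are Gaussian means of `E_n(x, z + iu)`, and `t^n / n! ≤ 2^{-n} e^{2t}`. -/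
theorem exists_kernelLTerm_bound (hR : IsRootSystem R)
    (hV : IsIntertwiner R β k (intertwiner R β k)) (x : CSpace d) :
    ∃ D A : ℝ, 0 ≤ D ∧ 0 ≤ A ∧ ∀ n z,
      ‖kernelLTerm R β k x z n‖ ≤ D * Real.exp (A * ‖z‖) * (1 / 2) ^ n := by
  obtain ⟨C, hC, hbound⟩ := exists_kernelE_bound hR hV
  -- `e^{2t}` with `t = 2 ‖x‖ ‖z + iu‖` is at most `e^{A (‖z‖ + ‖u‖)}`
  set A := 4 * hnorm x with hA
  have hx := hnorm_nonneg x
  set J := ∫ u : RSpace d, Real.exp (A * ‖u‖) * Real.exp (-‖u‖ ^ 2 / 2) with hJ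
  have hJ0 : 0 ≤ J := integral_nonneg fun u => by positivity
  have hc := c0_pos d
  refine ⟨(c0 d)⁻¹ * (C * J), A, by positivity, by positivity, fun n z => ?_⟩
  have hpt : ∀ u : RSpace d, ‖eval (toC z + Complex.I • toC u) (kernelPolyRight R β k n x) *
      gauss (0 - toC u)‖ ≤ C * Real.exp (A * ‖z‖) * (1 / 2) ^ n *
        (Real.exp (A * ‖u‖) * Real.exp (-‖u‖ ^ 2 / 2)) := by
    intro u
    have h1 : hnorm (toC z + Complex.I • toC u) ≤ ‖z‖ + ‖u‖ := by
      refine (hnorm_add_le _ _).trans_eq ?_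
      rw [hnorm_smul, hnorm_toC, hnorm_toC, Complex.norm_I, one_mul]
    have h2 : ‖kernelE R β k n x (toC z + Complex.I • toC u)‖ ≤
        C * ((1 / 2) ^ n * Real.exp (A * (‖z‖ + ‖u‖))) := by
      refine (hbound _ _ _).trans (mul_le_mul_of_nonneg_left ?_ hC)
      have h3 : 0 ≤ 2 * (hnorm x * hnorm (toC z + Complex.I • toC u)) :=
        mul_nonneg zero_le_two (mul_nonneg hx (hnorm_nonneg _))
      have h4 : 2 * (2 * (hnorm x * hnorm (toC z + Complex.I • toC u))) ≤ A * (‖z‖ + ‖u‖) := by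
        rw [hA]
        nlinarith [mul_le_mul_of_nonneg_left h1 hx]
      generalize 2 * (hnorm x * hnorm (toC z + Complex.I • toC u)) = T at h3 h4 ⊢
      calc T ^ n / (n.factorial : ℝ) = (1 / 2) ^ n * ((2 * T) ^ n / (n.factorial : ℝ)) := by
            rw [← mul_div_assoc, ← mul_pow, one_div, inv_mul_cancel_left₀ two_ne_zero]
        _ ≤ (1 / 2) ^ n * Real.exp (A * (‖z‖ + ‖u‖)) :=
            mul_le_mul_of_nonneg_left ((Real.pow_div_factorial_le_exp _ (by linarith) n).trans
              (Real.exp_le_exp.2 h4)) (by positivity)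
    have h5 : ‖gauss (0 - toC u)‖ ≤ Real.exp (-‖u‖ ^ 2 / 2) := by
      have := norm_gauss_le 0 u
      simpa [hnorm_eq_zero.2] using this
    rw [norm_mul, eval_kernelPolyRight]
    calc _ ≤ C * ((1 / 2) ^ n * Real.exp (A * (‖z‖ + ‖u‖))) * Real.exp (-‖u‖ ^ 2 / 2) :=
          mul_le_mul h2 h5 (norm_nonneg _) (by positivity)
      _ = _ := by
          rw [mul_add, Real.exp_add]
          ring
  have hint := integral_eval_add_I_smul (kernelPolyRight R β k n x) z
  have h6 : ‖((c0 d : ℝ) : ℂ) * kernelLTerm R β k x z n‖ ≤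
      C * Real.exp (A * ‖z‖) * (1 / 2) ^ n * J := by
    rw [kernelLTerm_eq, ← hint, hJ, ← integral_const_mul]
    exact norm_integral_le_of_norm_le ((integrable_exp_mul_norm A).const_mul _)
      (Filter.Eventually.of_forall hpt)
  rw [norm_mul, Complex.norm_real, Real.norm_of_nonneg hc.le] at h6
  calc ‖kernelLTerm R β k x z n‖ = (c0 d)⁻¹ * (c0 d * ‖kernelLTerm R β k x z n‖) := by
        rw [inv_mul_cancel_left₀ hc.ne']
    _ ≤ (c0 d)⁻¹ * (C * Real.exp (A * ‖z‖) * (1 / 2) ^ n * J) :=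
        mul_le_mul_of_nonneg_left h6 (by positivity)
    _ = _ := by ring

theorem summable_kernelLTerm (hR : IsRootSystem R)
    (hV : IsIntertwiner R β k (intertwiner R β k)) (x : CSpace d) (z : RSpace d) :
    Summable (kernelLTerm R β k x z) := by
  obtain ⟨D, A, _, _, hbound⟩ := exists_kernelLTerm_bound hR hV x
  exact .of_norm_bounded (summable_geometric_two.mul_left _) fun n => hbound n z

/-- The geometric bound on the terms dominates the partial sums of `L_k(x, ·)` by an integrable
function, so the series may be integrated term by term; each term has the Gauss transform
`E_n(x, y)`, up to the factor `c_0`. -/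
theorem integrable_kernelL_and_hasSum (hR : IsRootSystem R)
    (hV : IsIntertwiner R β k (intertwiner R β k)) (x y : CSpace d) :
    Integrable (fun z : RSpace d => kernelL R β k x z * gauss (y - toC z)) ∧
      HasSum (fun n => ((c0 d : ℝ) : ℂ) * kernelE R β k n x y)
        (∫ z : RSpace d, kernelL R β k x z * gauss (y - toC z)) := by
  obtain ⟨D, A, hD, hA, hbound⟩ := exists_kernelLTerm_bound hR hV x
  have hcont : ∀ n, Continuous fun z => kernelLTerm R β k x z n := fun n => by
    simp only [kernelLTerm_eq]
    exact (differentiable_polyFun _).continuous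
  have hsum : ∀ z, HasSum (fun n => kernelLTerm R β k x z n * gauss (y - toC z))
      (kernelL R β k x z * gauss (y - toC z)) := fun z =>
    (summable_kernelLTerm hR hV x z).hasSum.mul_right _
  have hmeas : ∀ n, AEStronglyMeasurable
      (fun z : RSpace d => kernelLTerm R β k x z n * gauss (y - toC z)) := fun n =>
    ((hcont n).mul (continuous_gauss y)).aestronglyMeasurable
  have hdom : Integrable fun z : RSpace d => D * Real.exp (A * ‖z‖) * ‖gauss (y - toC z)‖ := by
    have h : HasExpGrowth fun z : RSpace d => ((D * Real.exp (A * ‖z‖) : ℝ) : ℂ) :=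
      ⟨by fun_prop, D, A, hD, hA, fun z => by
        rw [Complex.norm_real, Real.norm_of_nonneg (by positivity)]⟩
    refine (h.integrable_mul_gauss y).norm.congr (Filter.Eventually.of_forall fun z => ?_)
    beta_reduce
    rw [norm_mul, Complex.norm_real, Real.norm_of_nonneg (by positivity)]
  have hterm : ∀ n z, ‖kernelLTerm R β k x z n * gauss (y - toC z)‖ ≤
      D * Real.exp (A * ‖z‖) * ‖gauss (y - toC z)‖ * (1 / 2) ^ n := fun n z => by
    rw [norm_mul, mul_right_comm]
    exact mul_le_mul_of_nonneg_right (hbound n z) (norm_nonneg _)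
  have hgeom : ∀ c : ℝ, HasSum (fun n : ℕ => c * (1 / 2) ^ n) (c * 2) := fun c =>
    hasSum_geometric_two.mul_left c
  constructor
  · refine (hdom.mul_const 2).mono' ?_ (Filter.Eventually.of_forall fun z => ?_)
    · exact aestronglyMeasurable_of_tendsto_ae (u := Filter.atTop)
        (f := fun N z => ∑ n ∈ Finset.range N, kernelLTerm R β k x z n * gauss (y - toC z))
        (fun N => Finset.aestronglyMeasurable_fun_sum _ fun n _ => hmeas n)
        (Filter.Eventually.of_forall fun z => (hsum z).tendsto_sum_nat)
    · rw [← (hsum z).tsum_eq]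
      exact tsum_of_norm_bounded (hgeom _) fun n => hterm n z
  · have h := hasSum_integral_of_dominated_convergence
      (F := fun n (z : RSpace d) => kernelLTerm R β k x z n * gauss (y - toC z))
      (fun n z => D * Real.exp (A * ‖z‖) * ‖gauss (y - toC z)‖ * (1 / 2) ^ n) hmeas
      (fun n => Filter.Eventually.of_forall (hterm n))
      (Filter.Eventually.of_forall fun z => (hgeom _).summable)
      (by simpa only [(hgeom _).tsum_eq] using hdom.mul_const 2)
      (Filter.Eventually.of_forall hsum)
    simp only [kernelLTerm_eq, integral_expNegHalfPolyLaplacian, eval_kernelPolyRight] at h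
    exact h

theorem dunklKernel_eq_integral (hR : IsRootSystem R) (hkM : InMStar R β k)
    (hV : IsIntertwiner R β k (intertwiner R β k)) (x y : CSpace d) :
    dunklKernel R β k x y = ((c0 d : ℝ) : ℂ)⁻¹ *
      ∫ z : RSpace d, kernelL R β k x z * gauss (y - toC z) := by
  have h1 := (integrable_kernelL_and_hasSum hR hV x y).2
  have h2 := (hasSum_kernelE hR hkM hV x y).mul_left ((c0 d : ℝ) : ℂ)
  have hc : ((c0 d : ℝ) : ℂ) ≠ 0 := by exact_mod_cast (c0_pos d).ne'
  rw [h1.unique h2, inv_mul_cancel_left₀ hc]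

end

end Dunkl

theorem mainTheorem3 (d : ℕ) (R : Finset (Dunkl.RSpace d)) (hR : Dunkl.IsRootSystem R)
    (β : Dunkl.RSpace d) (hβ : ∀ α ∈ R, (inner ℝ α β : ℝ) ≠ 0)
    (k : Dunkl.RSpace d → ℂ) (hk : Dunkl.IsParameter R k) (hkM : Dunkl.InMStar R β k) :
    -- the intertwining operator and the Dunkl kernel are well defined
    Dunkl.IsIntertwiner R β k (Dunkl.intertwiner R β k) ∧
    (∀ V, Dunkl.IsIntertwiner R β k V → V = Dunkl.intertwiner R β k) ∧
    Dunkl.IsDunklKernel R β k (Dunkl.dunklKernel R β k) ∧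
    (∀ E, Dunkl.IsDunklKernel R β k E → E = Dunkl.dunklKernel R β k) ∧
    -- the series defining `L_k` converges absolutely
    (∀ (x : Dunkl.CSpace d) (z : Dunkl.RSpace d), Summable (Dunkl.kernelLTerm R β k x z)) ∧
    -- the integral representation
    ∀ x y : Dunkl.CSpace d,
      MeasureTheory.Integrable (fun z : Dunkl.RSpace d =>
        Dunkl.kernelL R β k x z *
          Complex.exp (-Dunkl.pairing (y - Dunkl.toC z) (y - Dunkl.toC z) / 2)) ∧
      Dunkl.dunklKernel R β k x y =
        ((Dunkl.c0 d : ℝ) : ℂ)⁻¹ * ∫ z : Dunkl.RSpace d, Dunkl.kernelL R β k x z *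
          Complex.exp (-Dunkl.pairing (y - Dunkl.toC z) (y - Dunkl.toC z) / 2) ∧
      Dunkl.dunklKernel R β k x y =
        ((Dunkl.c0 d : ℝ) : ℂ)⁻¹ * Dunkl.cconv (Dunkl.kernelL R β k x) Dunkl.gauss y := by
  have hV := Dunkl.isIntertwiner_intertwiner hR hβ hk hkM
  have hE := Dunkl.isDunklKernel_dunklKernel hR hV
  refine ⟨hV, fun V h => h.unique hR hkM hV, hE, fun E h => h.unique hkM hE,
    Dunkl.summable_kernelLTerm hR hV, fun x y => ?_⟩
  have h := Dunkl.dunklKernel_eq_integral hR hkM hV x y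
  exact ⟨(Dunkl.integrable_kernelL_and_hasSum hR hV x y).1, h, h⟩
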